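/- **Setting.** Let $\sigma>0$, $\delta\in(0,1)$, $\epsilon\in\mathbb{R}$. Let $f$ be a sample from a Gaussian process on $\mathcal{X}$ with zero mean and covariance kernel $\kappa$ satisfying $\kappa(x,x)\le 1$ for all $x\in\mathcal X$. Sampling at time $t$ at a point $x$ returns $f(x)+\epsilon_t$, with noise variables $\epsilon_t\sim\mathcal N(0,\sigma^2)$ that are i.i.d. and independent of $f$. For a finite list $D=(d_1,\dots,d_M)$ of points with targets $\mathbf y_D\in\mathbb R^M$ put $k_D(x)=(\kappa(d_i,x))_i$, $K_D=(\kappa(d_i,d_j))_{i,j}$, $$\mu_D(x)=k_D(x)^T(K_D+\sigma^2I)^{-1}\mathbf y_D,\qquad \sigma_D^2(x)=\kappa(x,x)-k_D(x)^T(K_D+\sigma^2I)^{-1}k_D(x).$$ **Algorithm (compressed GP-UCB).** Start with $D_0$ empty. At times $t=1,2,\dots$ select, by a (measurable) rule depending on $t$ and the data held, $$x_t\in\operatorname{argmax}_{x\in\mathcal X}\ \mu_{D_{t-1}}(x)+\sqrt{\beta_t}\,\sigma_{D_{t-1}}(x).$$ If $\tfrac12\log\big(2\pi e(\sigma^2+\sigma^2_{D_{t-1}}(x_t))\big)>\epsilon$,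 sample $y_t=f(x_t)+\epsilon_t$ and append $x_t$ to the dictionary and $y_t$ to the targets; otherwise leave both unchanged. Let $\mathcal M_T(\epsilon)\subset\{1,\dots,T\}$ be the set of update times, $M_T(\epsilon)=|\mathcal M_T(\epsilon)|$ the number of elements of the dictionary after $T$ iterations, and $$\widetilde{\mathbf{Reg}}_T=\sum_{t\in\mathcal M_T(\epsilon)}\big(f(x^*)-f(x_t)\big),\qquad x^*\in\operatorname{argmax}_{x\in\mathcal X}f(x).$$ For $n\ge0$ let $\gamma_n=\sup_{x_1,\dots,x_n\in\mathcal X}I(\{y_u\}_{u=1}^n;f)$ (repetitions allowed) be the maximum information gain, where $I(\{y_u\};f)=H(\{y_u\})-H(\{y_u\}\mid f)=H(\mathcal N(0,K+\sigma^2I))-H(\mathcal N(0,\sigma^2I))$ with $K=(\kappa(x_i,x_j))_{i,j}$ and $H(\mathcal N(\mu,\Sigma))=\frac12\log|2\pi e\Sigma|$. Put $C_1=8/\log(1+\sigma^{-2})$. **Theorem 1 (Regret of Compressed GP-UCB).** The following hold for every $T$. (i) (Finite decision set) If $\mathcal X$ is finite with $|\mathcal X|=X$ and $\beta_t=2\log\big(Xt^2\pi^2/(6\delta)\big)$,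 then $$\mathbb P\Big\{\widetilde{\mathbf{Reg}}_T\le\sqrt{C_1M_T(\epsilon)\,\beta_T\,\gamma_{M_T(\epsilon)}}\Big\}\ge1-\delta.$$ (ii) (General decision set) Let $\mathcal X\subset[0,r]^d$ be compact and convex, $r>0$. Assume that the sample paths of $f$ are almost surely differentiable on $\mathcal X$ and that, for constants $a,b>0$, $$\mathbb P\Big\{\sup_{x\in\mathcal X}|\partial f/\partial x_j|>L\Big\}\le a\,e^{-(L/b)^2}\qquad\text{for all }L>0,\ j=1,\dots,d.$$ If $\beta_t=2\log\big(2t^2\pi^2/(3\delta)\big)+2d\log\big(t^2dbr\sqrt{\log(4da/\delta)}\big)$, then $$\mathbb P\Big\{\widetilde{\mathbf{Reg}}_T\le\sqrt{C_1M_T(\epsilon)\,\beta_T\,\gamma_{M_T(\epsilon)}}+\frac{\pi^2}{6}\Big\}\ge1-\delta.$$ Here the square root of a negative number and $\log 0$ are read as $0$ (this can only matter in (ii)). -/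

import Mathlib

open MeasureTheory ProbabilityTheory Matrix

namespace CompressedGPUCB

noncomputable section

/-- Differential entropy `½ log |2πe Σ|` of a Gaussian vector with covariance matrix `S`. -/
def gaussianEntropy {n : ℕ} (S : Matrix (Fin n) (Fin n) ℝ) : ℝ :=
  1 / 2 * Real.log ((2 * Real.pi * Real.exp 1) • S).det

/-- Gram matrix `K` of the kernel `κ` at the points `x 0, …, x (n-1)`. -/
def gram {A : Type*} (κ : A → A → ℝ) {n : ℕ} (x : Fin n → A) : Matrix (Fin n) (Fin n) ℝ :=
  Matrix.of fun i j => κ (x i) (x j)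

/-- Information gain `I({y_u}; f) = H({y_u}) - H({y_u} | f)` for the observations
`y_u = f(x_u) + N(0, σ²)`: under the prior `GP(0, κ)` the vector of observations has covariance
`K + σ² I`, and given `f` it has covariance `σ² I`. -/
def infoGain {A : Type*} (κ : A → A → ℝ) (σ : ℝ) {n : ℕ} (x : Fin n → A) : ℝ :=
  gaussianEntropy (gram κ x + σ ^ 2 • (1 : Matrix (Fin n) (Fin n) ℝ)) -
    gaussianEntropy (σ ^ 2 • (1 : Matrix (Fin n) (Fin n) ℝ))

/-- Maximum information gain `γ_n` over `n` sampled points (a point may be sampled repeatedly). -/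
def maxInfoGain {A : Type*} (κ : A → A → ℝ) (σ : ℝ) (n : ℕ) : ℝ :=
  ⨆ x : Fin n → A, infoGain κ σ x

/-- The data held by the algorithm: the dictionary points together with their targets, in the
order in which they were added; the first component is the model order. -/
abbrev Data (A : Type*) : Type _ := Σ n : ℕ, (Fin n → A × ℝ)

/-- The dictionary points. -/
def Data.points {A : Type*} (D : Data A) : Fin D.1 → A := fun i => (D.2 i).1

/-- The target vector. -/
def Data.targets {A : Type*} (D : Data A) : Fin D.1 → ℝ := fun i => (D.2 i).2

/-- The empirical kernel map `k_D(x)`. -/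
def kvec {A : Type*} (κ : A → A → ℝ) (D : Data A) (x : A) : Fin D.1 → ℝ :=
  fun i => κ (D.points i) x

/-- The regularized Gram matrix `K_{D,D} + σ² I`. -/
def regGram {A : Type*} (κ : A → A → ℝ) (σ : ℝ) (D : Data A) : Matrix (Fin D.1) (Fin D.1) ℝ :=
  gram κ D.points + σ ^ 2 • (1 : Matrix (Fin D.1) (Fin D.1) ℝ)

/-- Posterior mean `μ_D(x) = k_D(x)ᵀ (K_{D,D} + σ² I)⁻¹ y_D`. -/
def postMean {A : Type*} (κ : A → A → ℝ) (σ : ℝ) (D : Data A) (x : A) : ℝ :=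
  kvec κ D x ⬝ᵥ ((regGram κ σ D)⁻¹ *ᵥ D.targets)

/-- Posterior variance `σ_D²(x) = κ(x, x) - k_D(x)ᵀ (K_{D,D} + σ² I)⁻¹ k_D(x)`. -/
def postVar {A : Type*} (κ : A → A → ℝ) (σ : ℝ) (D : Data A) (x : A) : ℝ :=
  κ x x - kvec κ D x ⬝ᵥ ((regGram κ σ D)⁻¹ *ᵥ kvec κ D x)

/-- The upper-confidence-bound acquisition function `μ_D(x) + √β σ_D(x)`. -/
def ucb {A : Type*} (κ : A → A → ℝ) (σ β : ℝ) (D : Data A) (x : A) : ℝ :=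
  postMean κ σ D x + √β * √(postVar κ σ D x)

/-- Conditional entropy `½ log (2πe (σ² + σ_D²(x)))` of an observation at `x` given the data. -/
def condEntropy {A : Type*} (κ : A → A → ℝ) (σ : ℝ) (D : Data A) (x : A) : ℝ :=
  1 / 2 * Real.log (2 * Real.pi * Real.exp 1 * (σ ^ 2 + postVar κ σ D x))

/-- `rule t D` is the action selected at time `t` when the data held is `D`. It is a UCB rule with
exploration parameters `β` if it always returns a maximizer of the acquisition function; ties are
broken measurably. -/
structure IsUCBRule {A : Type*} [MeasurableSpace A] (κ : A → A → ℝ) (σ : ℝ) (β : ℕ → ℝ)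
    (rule : ℕ → Data A → A) : Prop where
  measurable : ∀ t n, Measurable fun D : Fin n → A × ℝ => rule t ⟨n, D⟩
  isMax : ∀ t, 1 ≤ t → ∀ D x, ucb κ σ (β t) D x ≤ ucb κ σ (β t) D (rule t D)

open Classical in
/-- The data held by the compressed algorithm after `t` iterations, run on the payoff function `g`
with observation noise `e`: the action proposed at time `t + 1` is sampled and added exactly when
its conditional entropy exceeds the compression budget `ε`. -/
def run {A : Type*} (κ : A → A → ℝ) (σ ε : ℝ) (rule : ℕ → Data A → A) (g : A → ℝ) (e : ℕ → ℝ) :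
    ℕ → Data A
  | 0 => ⟨0, Fin.elim0⟩
  | t + 1 =>
    let D := run κ σ ε rule g e t
    let x := rule (t + 1) D
    if ε < condEntropy κ σ D x then
      ⟨D.1 + 1, Fin.snoc (α := fun _ => A × ℝ) D.2 (x, g x + e (t + 1))⟩
    else D

/-- The action `x_t` selected at time `t ≥ 1`. -/
def action {A : Type*} (κ : A → A → ℝ) (σ ε : ℝ) (rule : ℕ → Data A → A) (g : A → ℝ) (e : ℕ → ℝ)
    (t : ℕ) : A :=
  rule t (run κ σ ε rule g e (t - 1))

open Classical in
/-- The set of update times in `{1, …, T}`. -/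
def updateTimes {A : Type*} (κ : A → A → ℝ) (σ ε : ℝ) (rule : ℕ → Data A → A) (g : A → ℝ)
    (e : ℕ → ℝ) (T : ℕ) : Finset ℕ :=
  (Finset.Icc 1 T).filter fun t =>
    ε < condEntropy κ σ (run κ σ ε rule g e (t - 1)) (action κ σ ε rule g e t)

/-- The number `M_T(ε)` of elements of the dictionary after `T` iterations. -/
def modelOrder {A : Type*} (κ : A → A → ℝ) (σ ε : ℝ) (rule : ℕ → Data A → A) (g : A → ℝ)
    (e : ℕ → ℝ) (T : ℕ) : ℕ :=
  (run κ σ ε rule g e T).1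

/-- The model order is the number of update times. -/
theorem modelOrder_eq_card {A : Type*} (κ : A → A → ℝ) (σ ε : ℝ) (rule : ℕ → Data A → A)
    (g : A → ℝ) (e : ℕ → ℝ) (T : ℕ) :
    modelOrder κ σ ε rule g e T = (updateTimes κ σ ε rule g e T).card := by
  classical
  induction T with
  | zero => simp [modelOrder, updateTimes, run]
  | succ T ih =>
    unfold modelOrder updateTimes at *
    rw [← Finset.insert_Icc_right_eq_Icc_add_one (by omega), Finset.filter_insert]
    by_cases h : ε < condEntropy κ σ (run κ σ ε rule g e T) (rule (T + 1) (run κ σ ε rule g e T))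
    · rw [if_pos (by simpa [action] using h), Finset.card_insert_of_notMem (by simp), ← ih]
      simp [run, h]
    · rw [if_neg (by simpa [action] using h), ← ih]
      simp [run, h]

/-- The regret over the update times, `∑_{t ∈ ℳ_T(ε)} (max g - g(x_t))`. -/
def updateRegret {A : Type*} (κ : A → A → ℝ) (σ ε : ℝ) (rule : ℕ → Data A → A) (g : A → ℝ)
    (e : ℕ → ℝ) (T : ℕ) : ℝ :=
  ∑ t ∈ updateTimes κ σ ε rule g e T, ((⨆ x, g x) - g (action κ σ ε rule g e t))

/-- The quantity `√(C₁ M β γ_M)` with `C₁ = 8 / log (1 + σ⁻²)`. -/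
def regretBound {A : Type*} (κ : A → A → ℝ) (σ β : ℝ) (M : ℕ) : ℝ :=
  √(8 / Real.log (1 + (σ ^ 2)⁻¹) * M * β * maxInfoGain κ σ M)

/-- The observation model: the payoff `f` is a sample from the centred Gaussian process with
covariance kernel `κ`, and the noise variables are i.i.d. `N(0, σ²)` and independent of `f`. -/
structure IsGPModel {Ω A : Type*} [MeasurableSpace Ω] (P : Measure Ω) (κ : A → A → ℝ) (σ : ℝ)
    (f : A → Ω → ℝ) (η : ℕ → Ω → ℝ) : Prop where
  measurable_payoff : ∀ x, Measurable (f x)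
  gaussian : IsGaussianProcess f P
  mean_zero : ∀ x, ∫ ω, f x ω ∂P = 0
  covariance_eq : ∀ x x', cov[f x, f x'; P] = κ x x'
  measurable_noise : ∀ t, Measurable (η t)
  noise_law : ∀ t, P.map (η t) = gaussianReal 0 (σ ^ 2).toNNReal
  noise_indep : iIndepFun η P
  indep : IndepFun (fun ω x => f x ω) (fun ω t => η t ω) P

/-- `β_t = 2 log (X t² π² / (6δ))`, for a decision set with `X` elements. -/
def betaFinite (X : ℕ) (δ : ℝ) (t : ℕ) : ℝ :=
  2 * Real.log (X * t ^ 2 * Real.pi ^ 2 / (6 * δ))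

/-- `β_t = 2 log (2 t² π² / (3δ)) + 2 d log (t² d b r √(log (4 d a / δ)))`. -/
def betaGeneral (d : ℕ) (r a b δ : ℝ) (t : ℕ) : ℝ :=
  2 * Real.log (2 * t ^ 2 * Real.pi ^ 2 / (3 * δ)) +
    2 * d * Real.log (t ^ 2 * d * b * r * √(Real.log (4 * d * a / δ)))

/-- `g'` collects partial derivatives of `g` on `S`: at each `x ∈ S`, the function `g` on `S` is
differentiable with differential `v ↦ ∑ j, g' x j * v j`. -/
def HasPartialsOn {d : ℕ} (S : Set (Fin d → ℝ)) (g : (Fin d → ℝ) → ℝ)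
    (g' : (Fin d → ℝ) → Fin d → ℝ) : Prop :=
  ∀ x ∈ S, HasFDerivWithinAt g
    (∑ j, g' x j • (ContinuousLinearMap.proj j : (Fin d → ℝ) →L[ℝ] ℝ)) S x

end

end CompressedGPUCB

/-! The regret is handled on the event where all confidence bounds that are used hold. If f(y) ≤
μ(y) + √β σ(y) at a point y, and f(x_t) ≥ μ(x_t) − √β σ(x_t) at the selected point, maximality of
x_t gives f(y) − f(x_t) ≤ 2√β σ(x_t). Summing over update times, Cauchy–Schwarz leaves the sum of
posterior variances at the sampled points. Each sample multiplies the determinant of the regularized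
Gram matrix by σ² + σ_D²(x), so this sum is controlled by the information gain of the dictionary
(`sum_postVar_le`, `updateRegret_le`). Compression does no harm: rejected times change neither the
data nor the sum.

The delicate point is the confidence bound itself, since the dictionary is chosen adaptively from
noisy targets. Conditional distributions are avoided. For a fixed payoff, the law of the collected
data has an explicit density, the likelihood, with respect to the law of the data collected on the
zero payoff (`lintegral_run_eq`); the selection rule is the same function of the data in both runs
and cancels. Data of the zero run do not involve f, so Fubini freezes them, and it remains to bound
the f-integral of likelihood times the indicator of a large deviation for each deterministic data
set. There the regression residual is Gaussian and independent of the targets (`fixed_design_tail`).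
This yields `adaptive_tail` and `confidence_tail`, also at a point that depends on the data; hence
the lower bound at x_t needs no union bound over the decision set.

A finite decision set needs X + 1 one-sided events per time, each of probability at most
e^{−β_t/2}/2. In the general case, gradient tails give a Lipschitz constant in ℓ¹ off an event of
probability δ/4, and upper bounds are used only on a finite net inside the decision set with error
1/t². A packing argument (`exists_l1_net`) keeps the net size plus one below 6τ^d, which is what the
remaining budget 3δ/4 allows. The errors sum to at most π²/6. -/

namespace CompressedGPUCB

/-! ### One iteration of the algorithm. -/

section Step

variable {A : Type*} (κ : A → A → ℝ) (σ : ℝ)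

/-- The data obtained by adding a point with its target. -/
def Data.snoc (D : Data A) (a : A × ℝ) : Data A :=
  ⟨D.1 + 1, Fin.snoc (α := fun _ => A × ℝ) D.2 a⟩

open Classical in
/-- One iteration of the algorithm at time `t`, with payoff `g` and noise `e`. -/
noncomputable def step (ε : ℝ) (rule : ℕ → Data A → A) (g : A → ℝ) (t : ℕ) (D : Data A) (e : ℝ) :
    Data A :=
  if ε < condEntropy κ σ D (rule t D) then D.snoc (rule t D, g (rule t D) + e) else D

theorem run_succ (ε : ℝ) (rule : ℕ → Data A → A) (g : A → ℝ) (e : ℕ → ℝ) (t : ℕ) :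
    run κ σ ε rule g e (t + 1) =
      step κ σ ε rule g (t + 1) (run κ σ ε rule g e t) (e (t + 1)) := rfl

theorem run_congr (ε : ℝ) (rule : ℕ → Data A → A) (g : A → ℝ) {e e' : ℕ → ℝ} {t : ℕ}
    (h : ∀ s ∈ Finset.Icc 1 t, e s = e' s) :
    run κ σ ε rule g e t = run κ σ ε rule g e' t := by
  induction t with
  | zero => rfl
  | succ t ih =>
    rw [run_succ, run_succ, ih fun s hs => h s ?_, h (t + 1) (by simp)]
    simp only [Finset.mem_Icc] at hs ⊢
    omega

end Step

/-! ### Measurability of the posterior quantities and of the run. -/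

section Measurability

/-- A function of a parameter and of an element of a sigma type is measurable if it is so on each
fibre. -/
theorem measurable_prod_sigma {Z Y : Type*} {X : ℕ → Type*} [MeasurableSpace Z]
    [MeasurableSpace Y] [∀ n, MeasurableSpace (X n)] {F : Z × (Σ n, X n) → Y}
    (h : ∀ n, Measurable fun p : Z × X n => F (p.1, ⟨n, p.2⟩)) : Measurable F := by
  have hemb : ∀ n, MeasurableEmbedding (Sigma.mk n : X n → Σ n, X n) := by
    intro n
    have hm : ∀ m, Measurable (Sigma.mk m : X m → Σ n, X n) := fun m s hs => by
      have := (MeasurableSpace.measurableSet_iInf.mp hs) m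
      exact this
    refine ⟨sigma_mk_injective, hm n, fun s hs => ?_⟩
    refine MeasurableSpace.measurableSet_iInf.mpr fun m => ?_
    change MeasurableSet (Sigma.mk m ⁻¹' (Sigma.mk n '' s))
    by_cases hmn : m = n
    · subst hmn
      rwa [Set.preimage_image_eq _ sigma_mk_injective]
    · rw [Set.preimage_image_sigmaMk_of_ne hmn]
      exact MeasurableSet.empty
  intro s hs
  -- The fibres are measurably embedded and there are countably many of them, so the preimage is
  -- reassembled from its slices.
  have : F ⁻¹' s = ⋃ n, (Prod.map id (Sigma.mk n)) ''
      ((fun p : Z × X n => F (p.1, ⟨n, p.2⟩)) ⁻¹' s) := by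
    ext ⟨z, n, x⟩
    simp only [Set.mem_preimage, Set.mem_iUnion, Set.mem_image, Prod.map_apply, id_eq,
      Prod.mk.injEq, Prod.exists]
    constructor
    · intro hx
      exact ⟨n, z, x, hx, rfl, rfl⟩
    · rintro ⟨m, z', x', hx, rfl, hx'⟩
      rw [← hx']
      exact hx
  rw [this]
  exact MeasurableSet.iUnion fun n =>
    (MeasurableEmbedding.id.prodMap (hemb n)).measurableSet_image.mpr (h n hs)

theorem measurable_sigma_mk {X : ℕ → Type*} [∀ n, MeasurableSpace (X n)] (n : ℕ) :
    Measurable (Sigma.mk n : X n → Σ n, X n) := fun _ hs =>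
  MeasurableSpace.measurableSet_iInf.mp hs n

theorem measurable_of_sigma {Y : Type*} {X : ℕ → Type*}
    [MeasurableSpace Y] [∀ n, MeasurableSpace (X n)] {F : (Σ n, X n) → Y}
    (h : ∀ n, Measurable fun p : X n => F ⟨n, p⟩) : Measurable F :=
  fun _ hs => MeasurableSpace.measurableSet_iInf.mpr fun n => h n hs

/-- Determinant and adjugate are polynomial in the entries, and real inversion is measurable even at
zero, so no invertibility is needed. -/
theorem measurable_inv_apply {Z : Type*} [MeasurableSpace Z] {n : ℕ}
    {M : Z → Matrix (Fin n) (Fin n) ℝ} (hM : ∀ i j, Measurable fun z => M z i j) (i j : Fin n) :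
    Measurable fun z => (M z)⁻¹ i j := by
  have hM' : Measurable (fun z i j => M z i j) :=
    measurable_pi_lambda _ fun i => measurable_pi_lambda _ fun j => hM i j
  have c1 : Continuous fun N : Fin n → Fin n → ℝ => (Matrix.of N).det :=
    Continuous.matrix_det continuous_id
  have c2 : Continuous fun N : Fin n → Fin n → ℝ => (Matrix.of N).adjugate i j :=
    (Continuous.matrix_adjugate (A := fun N : Fin n → Fin n → ℝ => Matrix.of N)
      continuous_id).matrix_elem i j
  have h1 := c1.measurable
  have h2 := c2.measurable
  have : (fun z => (M z)⁻¹ i j) = fun z => (M z).det⁻¹ * (M z).adjugate i j := by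
    ext z
    rw [Matrix.inv_def, Ring.inverse_eq_inv']
    simp
  rw [this]
  exact ((h1.comp hM').inv).mul (h2.comp hM')

variable {A : Type*} [MeasurableSpace A] {κ : A → A → ℝ} (σ : ℝ)

theorem measurable_points (n : ℕ) (i : Fin n) :
    Measurable fun d : Fin n → A × ℝ => Data.points (⟨n, d⟩ : Data A) i :=
  (measurable_pi_apply i).fst

theorem measurable_targets (n : ℕ) (i : Fin n) :
    Measurable fun d : Fin n → A × ℝ => Data.targets (⟨n, d⟩ : Data A) i :=
  (measurable_pi_apply i).snd

theorem measurable_regGram_inv (hκ : Measurable (Function.uncurry κ)) (n : ℕ) (i j : Fin n) :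
    Measurable fun d : Fin n → A × ℝ => (regGram κ σ (⟨n, d⟩ : Data A))⁻¹ i j := by
  refine measurable_inv_apply (n := n) (fun i j => ?_) i j
  simp only [regGram, gram, Matrix.add_apply, Matrix.of_apply, Matrix.smul_apply]
  change Measurable fun d : Fin n → A × ℝ =>
    κ (d i).1 (d j).1 + σ ^ 2 • (1 : Matrix (Fin n) (Fin n) ℝ) i j
  exact (hκ.comp ((measurable_points n i).prodMk (measurable_points n j))).add_const _

theorem measurable_kvec (hκ : Measurable (Function.uncurry κ)) (n : ℕ) (i : Fin n) :
    Measurable fun p : A × (Fin n → A × ℝ) => kvec κ (⟨n, p.2⟩ : Data A) p.1 i :=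
  hκ.comp (((measurable_points n i).comp measurable_snd).prodMk measurable_fst)

theorem measurable_postMean (hκ : Measurable (Function.uncurry κ)) :
    Measurable fun p : A × Data A => postMean κ σ p.2 p.1 := by
  refine measurable_prod_sigma fun n => ?_
  change Measurable fun p : A × (Fin n → A × ℝ) => ∑ i : Fin n, kvec κ (⟨n, p.2⟩ : Data A) p.1 i *
    ∑ j : Fin n, (regGram κ σ (⟨n, p.2⟩ : Data A))⁻¹ i j * Data.targets (⟨n, p.2⟩ : Data A) j
  refine Finset.measurable_fun_sum _ fun i _ => (measurable_kvec hκ n i).fun_mul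
    (Finset.measurable_fun_sum _ fun j _ => ?_)
  exact ((measurable_regGram_inv σ hκ n i j).comp measurable_snd).fun_mul
    ((measurable_targets n j).comp measurable_snd)

theorem measurable_postVar (hκ : Measurable (Function.uncurry κ)) :
    Measurable fun p : A × Data A => postVar κ σ p.2 p.1 := by
  refine measurable_prod_sigma fun n => ?_
  change Measurable fun p : A × (Fin n → A × ℝ) => κ p.1 p.1 -
    ∑ i : Fin n, kvec κ (⟨n, p.2⟩ : Data A) p.1 i *
    ∑ j : Fin n, (regGram κ σ (⟨n, p.2⟩ : Data A))⁻¹ i j * kvec κ (⟨n, p.2⟩ : Data A) p.1 j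
  refine (hκ.comp (measurable_fst.prodMk measurable_fst)).sub
    (Finset.measurable_fun_sum _ fun i _ => (measurable_kvec hκ n i).fun_mul
    (Finset.measurable_fun_sum _ fun j _ => ?_))
  exact ((measurable_regGram_inv σ hκ n i j).comp measurable_snd).fun_mul (measurable_kvec hκ n j)

theorem measurable_condEntropy (hκ : Measurable (Function.uncurry κ)) :
    Measurable fun p : A × Data A => condEntropy κ σ p.2 p.1 :=
  (Real.measurable_log.comp ((measurable_const.add (measurable_postVar σ hκ)).const_mul
    _)).const_mul _

theorem measurable_snoc : Measurable fun p : (A × ℝ) × Data A => p.2.snoc p.1 := by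
  refine measurable_prod_sigma fun n => ?_
  refine (measurable_sigma_mk (X := fun n => Fin n → A × ℝ) (n + 1)).comp
    (measurable_pi_lambda _ fun i => ?_)
  refine Fin.lastCases ?_ (fun i => ?_) i
  · simp only [Fin.snoc_last]
    exact measurable_fst
  · simp only [Fin.snoc_castSucc]
    exact (measurable_pi_apply i).comp measurable_snd

theorem measurable_step (hκ : Measurable (Function.uncurry κ)) (ε : ℝ) {rule : ℕ → Data A → A}
    {t : ℕ} (hr : Measurable (rule t)) {Z : Type*} [MeasurableSpace Z] {g : Z → A → ℝ}
    (hg : Measurable (Function.uncurry g)) {D : Z → Data A} (hD : Measurable D) {e : Z → ℝ}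
    (he : Measurable e) : Measurable fun z => step κ σ ε rule (g z) t (D z) (e z) := by
  have hx : Measurable fun z => rule t (D z) := hr.comp hD
  refine Measurable.ite ?_ ?_ hD
  · exact measurableSet_lt measurable_const ((measurable_condEntropy σ hκ).comp (hx.prodMk hD))
  · exact measurable_snoc.comp ((hx.prodMk ((hg.comp (measurable_id.prodMk hx)).add he)).prodMk hD)

theorem measurable_run (hκ : Measurable (Function.uncurry κ)) (ε : ℝ) {rule : ℕ → Data A → A}
    (hr : ∀ t, Measurable (rule t)) {Z : Type*} [MeasurableSpace Z] {g : Z → A → ℝ}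
    (hg : Measurable (Function.uncurry g)) {e : Z → ℕ → ℝ} (he : ∀ t, Measurable fun z => e z t)
    (t : ℕ) : Measurable fun z => run κ σ ε rule (g z) (e z) t := by
  induction t with
  | zero => exact measurable_const
  | succ t ih => exact measurable_step σ hκ ε (hr _) hg ih (he _)

end Measurability

/-! ### Positivity of covariance matrices. -/

section Kernel

variable {Ω A : Type*} [MeasurableSpace Ω] {P : Measure Ω} [IsProbabilityMeasure P]
  {κ : A → A → ℝ} {f : A → Ω → ℝ}

/-- The quadratic form is the variance of a linear combination of values of the process. -/
theorem gram_posSemidef (hL : ∀ x, MemLp (f x) 2 P) (hcov : ∀ x x', cov[f x, f x'; P] = κ x x')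
    {n : ℕ} (p : Fin n → A) : (gram κ p).PosSemidef := by
  refine Matrix.PosSemidef.of_dotProduct_mulVec_nonneg ?_ fun c => ?_
  · ext i j
    simp only [gram, Matrix.conjTranspose_apply, Matrix.of_apply, star_trivial, ← hcov]
    exact covariance_comm _ _
  · have h : star c ⬝ᵥ (gram κ p *ᵥ c) =
        cov[fun ω => ∑ i, c i * f (p i) ω, fun ω => ∑ i, c i * f (p i) ω; P] := by
      rw [covariance_fun_sum_fun_sum (fun i => (hL (p i)).const_mul _)
        (fun i => (hL (p i)).const_mul _)]
      simp only [dotProduct, Matrix.mulVec, gram, Matrix.of_apply, covariance_const_mul_left,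
        covariance_const_mul_right, hcov, Finset.mul_sum, Pi.star_apply, star_trivial]
      refine Finset.sum_congr rfl fun i _ => Finset.sum_congr rfl fun j _ => ?_
      ring
    rw [h, covariance_self]
    · exact variance_nonneg _ _
    · exact (memLp_finsetSum _ fun i _ => (hL (p i)).const_mul _).aestronglyMeasurable.aemeasurable

theorem add_smul_one_posDef {n : ℕ} {K : Matrix (Fin n) (Fin n) ℝ} (hK : K.PosSemidef) {σ : ℝ}
    (hσ : 0 < σ) : (K + σ ^ 2 • (1 : Matrix (Fin n) (Fin n) ℝ)).PosDef :=
  Matrix.PosDef.posSemidef_add hK (Matrix.PosDef.one.smul (by positivity))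

end Kernel

/-! ### Gaussian tails and regression residuals. -/

theorem gaussianReal_Ioi_zero_le (v : NNReal) :
    gaussianReal 0 v (Set.Ioi 0) ≤ ENNReal.ofReal (1 / 2) := by
  have h1 : gaussianReal 0 v (Set.Iio 0) = gaussianReal 0 v (Set.Ioi 0) := by
    have h := gaussianReal_map_neg (μ := 0) (v := v)
    rw [neg_zero] at h
    conv_lhs => rw [← h]
    rw [Measure.map_apply measurable_neg measurableSet_Iio]
    congr 1
    ext z
    simp
  have h2 : gaussianReal 0 v (Set.Iio 0) + gaussianReal 0 v (Set.Ioi 0) ≤ 1 := by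
    rw [← measure_union (Set.disjoint_left.mpr fun z hz hz' =>
      lt_asymm (Set.mem_Iio.mp hz) (Set.mem_Ioi.mp hz')) measurableSet_Ioi]
    exact prob_le_one
  rw [h1, ← two_mul] at h2
  rw [ENNReal.ofReal_div_of_pos (by norm_num), ENNReal.ofReal_one, ENNReal.ofReal_ofNat,
    ENNReal.le_div_iff_mul_le (by simp) (by simp), mul_comm]
  exact h2

/-- Upper tail of a centred Gaussian variable. -/
theorem gaussianReal_tail_le (v : NNReal) {c : ℝ} (hc : 0 ≤ c) :
    gaussianReal 0 v {z | c * √v < z} ≤ ENNReal.ofReal (1 / 2 * Real.exp (-c ^ 2 / 2)) := by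
  rcases eq_or_ne v 0 with rfl | hv
  · simp
  have hv' : (0 : ℝ) < v := by positivity
  -- Expanding the square in the exponent, the cross term has a favourable sign for u > 0 and is
  -- dropped. Keeping the half line rather than all of ℝ preserves the factor 1/2.
  have hpt : ∀ u : ℝ, 0 < u → gaussianPDF 0 v (u + c * √v) ≤
      ENNReal.ofReal (Real.exp (-c ^ 2 / 2)) * gaussianPDF 0 v u := by
    intro u hu
    simp only [gaussianPDF]
    rw [← ENNReal.ofReal_mul (Real.exp_pos _).le]
    refine ENNReal.ofReal_le_ofReal ?_
    simp only [gaussianPDFReal]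
    rw [mul_left_comm, ← Real.exp_add]
    refine mul_le_mul_of_nonneg_left (Real.exp_le_exp.mpr ?_) (by positivity)
    have h2 : c ^ 2 = (c * √v) ^ 2 / v := by
      rw [mul_pow, Real.sq_sqrt hv'.le]
      field_simp
    have h3 : 0 ≤ u * (c * √v) := by positivity
    have h4 : -c ^ 2 / 2 + -(u - 0) ^ 2 / (2 * v) - -(u + c * √v - 0) ^ 2 / (2 * v) =
        u * (c * √v) / v := by
      rw [h2]
      field_simp
      ring
    have h5 : 0 ≤ u * (c * √v) / v := by positivity
    linarith
  have e1 : gaussianReal 0 v {z | c * √v < z} =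
      ∫⁻ u in Set.Ioi 0, gaussianPDF 0 v (u + c * √v) := by
    have hs : MeasurableSet {z : ℝ | c * √v < z} := measurableSet_Ioi
    rw [gaussianReal_apply 0 hv, ← lintegral_indicator hs, ← lintegral_indicator measurableSet_Ioi,
      ← lintegral_add_right_eq_self _ (c * √v)]
    congr 1 with u
    simp [Set.indicator]
  rw [e1]
  calc ∫⁻ u in Set.Ioi 0, gaussianPDF 0 v (u + c * √v)
      ≤ ∫⁻ u in Set.Ioi 0, ENNReal.ofReal (Real.exp (-c ^ 2 / 2)) * gaussianPDF 0 v u :=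
        setLIntegral_mono' measurableSet_Ioi fun u hu => hpt u hu
    _ = ENNReal.ofReal (Real.exp (-c ^ 2 / 2)) * gaussianReal 0 v (Set.Ioi 0) := by
        rw [lintegral_const_mul _ (measurable_gaussianPDF _ _), gaussianReal_apply 0 hv]
    _ ≤ ENNReal.ofReal (Real.exp (-c ^ 2 / 2)) * ENNReal.ofReal (1 / 2) := by
        gcongr
        exact gaussianReal_Ioi_zero_le v
    _ = _ := by
        rw [← ENNReal.ofReal_mul (Real.exp_pos _).le, mul_comm]

/-- The residual of the linear regression of `U` on `Y` for a centred Gaussian vector `(U, Y)` is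
independent of `Y`, and its variance is the Schur complement. -/
theorem residual_indepFun_and_law {Ω : Type*} [MeasurableSpace Ω] {Q : Measure Ω}
    [IsProbabilityMeasure Q] {n : ℕ} {U : Ω → ℝ} {Y : Fin n → Ω → ℝ}
    (hG : HasGaussianLaw (fun ω => (U ω, fun i => Y i ω)) Q)
    (hU0 : ∫ ω, U ω ∂Q = 0) (hY0 : ∀ i, ∫ ω, Y i ω ∂Q = 0)
    {u : ℝ} {k : Fin n → ℝ} {M : Matrix (Fin n) (Fin n) ℝ} (hM : M.PosDef)
    (hUU : cov[U, U; Q] = u) (hUY : ∀ j, cov[U, Y j; Q] = k j)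
    (hYY : ∀ i j, cov[Y i, Y j; Q] = M i j) :
    IndepFun (fun ω => U ω - ∑ i, (M⁻¹ *ᵥ k) i * Y i ω) (fun ω i => Y i ω) Q ∧
      Q.map (fun ω => U ω - ∑ i, (M⁻¹ *ᵥ k) i * Y i ω) =
        gaussianReal 0 (u - k ⬝ᵥ (M⁻¹ *ᵥ k)).toNNReal ∧ 0 ≤ u - k ⬝ᵥ (M⁻¹ *ᵥ k) := by
  set w := M⁻¹ *ᵥ k with hw
  set R : Ω → ℝ := fun ω => U ω - ∑ i, w i * Y i ω with hR
  have hUL : MemLp U 2 Q := hG.fst.memLp_two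
  have hYL : ∀ i, MemLp (Y i) 2 Q := fun i => (hG.snd.eval i).memLp_two
  have hSL : MemLp (fun ω => ∑ i, w i * Y i ω) 2 Q :=
    memLp_finsetSum _ fun i _ => (hYL i).const_mul _
  have hRL : MemLp R 2 Q := hUL.sub hSL
  -- The normal equations: they make the residual uncorrelated with every coordinate of Y.
  have hMw : ∀ j, ∑ i, w i * M i j = k j := by
    intro j
    have h1 : M *ᵥ w = k := by
      rw [hw, Matrix.mulVec_mulVec, Matrix.mul_nonsing_inv _ hM.det_pos.ne'.isUnit,
        Matrix.one_mulVec]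
    have hs : ∀ i, M i j = M j i := fun i => by
      have := hM.isHermitian.apply i j
      simpa using this.symm
    rw [← congrFun h1 j]
    simp only [Matrix.mulVec, dotProduct, hs]
    exact Finset.sum_congr rfl fun i _ => mul_comm _ _
  have hRY : ∀ j, cov[R, Y j; Q] = 0 := by
    intro j
    rw [hR, covariance_fun_sub_left hUL hSL (hYL j), hUY,
      covariance_fun_sum_left (fun i => (hYL i).const_mul _) (hYL j)]
    simp only [covariance_const_mul_left, hYY, hMw, sub_self]
  have hRR : cov[R, R; Q] = u - k ⬝ᵥ w := by
    -- R differs from U by a combination of the Y's, with which it is uncorrelated.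
    have h1 : cov[R, R; Q] = cov[R, U; Q] := by
      conv_lhs => rw [hR]
      rw [← hR, covariance_fun_sub_right hRL hUL hSL,
        covariance_fun_sum_right (fun i => (hYL i).const_mul _) hRL]
      simp only [covariance_const_mul_right, hRY, mul_zero, Finset.sum_const_zero, sub_zero]
    rw [h1, hR, covariance_fun_sub_left hUL hSL hUL, hUU,
      covariance_fun_sum_left (fun i => (hYL i).const_mul _) hUL]
    congr 1
    refine Finset.sum_congr rfl fun i _ => ?_
    rw [covariance_const_mul_left, covariance_comm, hUY, mul_comm]
  let T : ℝ × (Fin n → ℝ) →L[ℝ] (Fin 1 → ℝ) × (Fin n → ℝ) :=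
    ContinuousLinearMap.prod (ContinuousLinearMap.pi fun _ =>
      ContinuousLinearMap.fst ℝ ℝ (Fin n → ℝ) -
        ∑ i, w i • (ContinuousLinearMap.proj i ∘L ContinuousLinearMap.snd ℝ ℝ (Fin n → ℝ)))
      (ContinuousLinearMap.snd ℝ ℝ (Fin n → ℝ))
  -- Joint Gaussianity upgrades zero covariance to independence.
  have hRYG : HasGaussianLaw (fun ω => ((fun _ : Fin 1 => R ω), fun j => Y j ω)) Q := by
    have hT : (fun ω => ((fun _ : Fin 1 => R ω), fun j => Y j ω)) =
        fun ω => T (U ω, fun i => Y i ω) := by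
      ext ω j
      · simp [T, hR]
      · simp [T]
    rw [hT]
    exact hG.map_fun T
  have hind := hRYG.indepFun_of_covariance_eval (X := fun _ : Fin 1 => R) (Y := Y)
    fun _ j => hRY j
  have hRG : HasGaussianLaw R Q := hRYG.fst.eval 0
  have hvar : Var[R; Q] = u - k ⬝ᵥ w := by
    rw [← hRR, covariance_self hRG.aemeasurable]
  have hmean : ∫ ω, R ω ∂Q = 0 := by
    rw [hR, integral_sub (hUL.integrable (by norm_num)) (hSL.integrable (by norm_num)), hU0,
      integral_finsetSum _ fun i _ => ((hYL i).const_mul _).integrable (by norm_num)]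
    simp [integral_const_mul, hY0]
  refine ⟨hind.comp (measurable_pi_apply 0) measurable_id, ?_, ?_⟩
  · rw [hRG.map_eq_gaussianReal, hvar, hmean]
  · rw [← hvar]
    exact variance_nonneg _ _

/-! ### Densities of shifted Gaussian noise. -/

/-- Product of densities as a density of the product measure. -/
theorem pi_withDensity_eq {n : ℕ} (μ : Fin n → Measure ℝ) [∀ i, IsProbabilityMeasure (μ i)]
    (h : Fin n → ℝ → ENNReal) (hh : ∀ i, Measurable (h i))
    [∀ i, SigmaFinite ((μ i).withDensity (h i))] :
    Measure.pi (fun i => (μ i).withDensity (h i)) =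
      (Measure.pi μ).withDensity fun y => ∏ i, h i (y i) := by
  refine Measure.pi_eq fun s hs => ?_
  rw [withDensity_apply _ (MeasurableSet.univ_pi hs),
    ← lintegral_indicator (MeasurableSet.univ_pi hs)]
  have h1 : ∀ y : Fin n → ℝ, (Set.univ.pi s).indicator (fun y => ∏ i, h i (y i)) y =
      ∏ i, (s i).indicator (h i) (y i) := by
    intro y
    by_cases hy : y ∈ Set.univ.pi s
    · rw [Set.indicator_of_mem hy]
      exact Finset.prod_congr rfl fun i _ =>
        (Set.indicator_of_mem (hy i (Set.mem_univ i)) (h i)).symm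
    · rw [Set.indicator_of_notMem hy]
      simp only [Set.mem_pi, Set.mem_univ, true_implies, not_forall] at hy
      obtain ⟨i, hi⟩ := hy
      exact (Finset.prod_eq_zero (Finset.mem_univ i) (Set.indicator_of_notMem hi _)).symm
  simp_rw [h1]
  have hind : iIndepFun (fun i (y : Fin n → ℝ) => (s i).indicator (h i) (y i)) (Measure.pi μ) :=
    iIndepFun_pi (X := fun i => (s i).indicator (h i))
      fun i => ((hh i).indicator (hs i)).aemeasurable
  rw [lintegral_prod_eq_prod_lintegral_of_indepFun _ _ hind
    fun i => ((hh i).indicator (hs i)).comp (measurable_pi_apply i)]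
  refine Finset.prod_congr rfl fun i _ => ?_
  rw [withDensity_apply _ (hs i), ← lintegral_indicator (hs i)]
  exact (measurePreserving_eval μ i).lintegral_comp ((hh i).indicator (hs i))

/-- Density of `N(m, v)` with respect to `N(0, v)`. -/
noncomputable def shiftDensity (v : NNReal) (m y : ℝ) : ℝ := Real.exp ((m * y - m ^ 2 / 2) / v)

theorem shiftDensity_pos (v : NNReal) (m y : ℝ) : 0 < shiftDensity v m y := Real.exp_pos _

theorem continuous_shiftDensity (v : NNReal) :
    Continuous fun p : ℝ × ℝ => shiftDensity v p.1 p.2 := by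
  unfold shiftDensity
  fun_prop

/-- Completing the square, my − m²/2 ≤ y²/2. The bound is uniform in the mean m, so it dominates the
likelihood over all payoffs while the targets stay bounded. -/
theorem shiftDensity_le (v : NNReal) (m : ℝ) {y C : ℝ} (hy : |y| ≤ C) :
    shiftDensity v m y ≤ Real.exp (C ^ 2 / (2 * v)) := by
  refine Real.exp_le_exp.mpr ?_
  rw [← div_div]
  refine div_le_div_of_nonneg_right ?_ v.2
  nlinarith [sq_nonneg (m - y), sq_abs y, abs_nonneg y]

theorem gaussianReal_eq_withDensity_shiftDensity {v : NNReal} (hv : v ≠ 0) (m : ℝ) :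
    gaussianReal m v =
      (gaussianReal 0 v).withDensity fun y => ENNReal.ofReal (shiftDensity v m y) := by
  have hm : Measurable fun y => ENNReal.ofReal (shiftDensity v m y) :=
    ((continuous_shiftDensity v).comp (by fun_prop : Continuous fun y : ℝ => (m, y))).measurable
      |>.ennreal_ofReal
  rw [gaussianReal_of_var_ne_zero m hv, gaussianReal_of_var_ne_zero 0 hv,
    ← withDensity_mul _ (measurable_gaussianPDF 0 v) hm]
  congr 1
  ext y
  have hv' : (0 : ℝ) < v := by positivity
  simp only [Pi.mul_apply, gaussianPDF]
  rw [← ENNReal.ofReal_mul (gaussianPDFReal_nonneg _ _ _)]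
  congr 1
  simp only [gaussianPDFReal, shiftDensity]
  conv_rhs => rw [mul_assoc, ← Real.exp_add]
  congr 2
  field_simp
  ring

theorem pi_gaussianReal_eq_withDensity {v : NNReal} (hv : v ≠ 0) {n : ℕ} (m : Fin n → ℝ) :
    Measure.pi (fun i => gaussianReal (m i) v) =
      (Measure.pi fun _ : Fin n => gaussianReal 0 v).withDensity
        fun y => ENNReal.ofReal (∏ i, shiftDensity v (m i) (y i)) := by
  have h : ∀ i, IsProbabilityMeasure
      ((gaussianReal 0 v).withDensity fun y => ENNReal.ofReal (shiftDensity v (m i) y)) := by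
    intro i
    rw [← gaussianReal_eq_withDensity_shiftDensity hv]
    infer_instance
  have hm : ∀ m : ℝ, Measurable fun y => ENNReal.ofReal (shiftDensity v m y) := fun m =>
    ((continuous_shiftDensity v).comp (by fun_prop : Continuous fun y : ℝ => (m, y))).measurable
      |>.ennreal_ofReal
  have e : (fun i => gaussianReal (m i) v) = fun i =>
      (gaussianReal 0 v).withDensity fun y => ENNReal.ofReal (shiftDensity v (m i) y) :=
    funext fun i => gaussianReal_eq_withDensity_shiftDensity hv (m i)
  rw [e, pi_withDensity_eq (fun _ => gaussianReal 0 v)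
    (fun i y => ENNReal.ofReal (shiftDensity v (m i) y)) fun i => hm (m i)]
  congr 1
  ext y
  rw [ENNReal.ofReal_prod_of_nonneg fun i _ => (shiftDensity_pos _ _ _).le]

theorem isOpenPosMeasure_gaussianReal {v : NNReal} (hv : v ≠ 0) :
    (gaussianReal 0 v).IsOpenPosMeasure :=
  (gaussianReal_absolutelyContinuous' 0 hv).isOpenPosMeasure

/-- Likelihood of the targets in `D` for the payoff `g`, relative to the zero payoff. -/
noncomputable def likelihood {A : Type*} (v : NNReal) (g : A → ℝ) (D : Data A) : ℝ :=
  ∏ i, shiftDensity v (g (D.points i)) (D.targets i)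

/-! ### Posterior tails for a deterministic design. -/

section FixedDesign

variable {Ω A : Type*} [MeasurableSpace Ω] {P : Measure Ω} [IsProbabilityMeasure P]
  {κ : A → A → ℝ} {f : A → Ω → ℝ}

theorem measurable_prod_shiftDensity (v : NNReal) {n : ℕ} {V : Fin n → Ω → ℝ}
    (hV : ∀ i, Measurable (V i)) : Measurable fun z : Ω × (Fin n → ℝ) =>
      ENNReal.ofReal (∏ i, shiftDensity v (V i z.1) (z.2 i)) := by
  refine (Finset.measurable_fun_prod _ fun i _ => ?_).ennreal_ofReal
  exact (continuous_shiftDensity v).measurable.comp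
    (((hV i).comp measurable_fst).prodMk ((measurable_pi_apply i).comp measurable_snd))

theorem continuous_prod_shiftDensity (v : NNReal) {n : ℕ} (m : Fin n → ℝ) :
    Continuous fun y : Fin n → ℝ => ENNReal.ofReal (∏ i, shiftDensity v (m i) (y i)) :=
  ENNReal.continuous_ofReal.comp <| continuous_finsetProd _ fun i _ =>
    (continuous_shiftDensity v).comp (continuous_const.prodMk (continuous_apply i))

theorem measurable_prod_shiftDensity_left (v : NNReal) {n : ℕ} {V : Fin n → Ω → ℝ}
    (hV : ∀ i, Measurable (V i)) (y : Fin n → ℝ) :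
    Measurable fun ω => ENNReal.ofReal (∏ i, shiftDensity v (V i ω) (y i)) := by
  refine (Finset.measurable_fun_prod _ fun i _ => ?_).ennreal_ofReal
  exact (continuous_shiftDensity v).measurable.comp ((hV i).prodMk measurable_const)

/-- Change of variables from the noise to the noisy observations of `V`. -/
theorem lintegral_add_noise {v : NNReal} (hv : v ≠ 0) {n : ℕ} {V : Fin n → Ω → ℝ}
    (hV : ∀ i, Measurable (V i)) {H : Ω × (Fin n → ℝ) → ENNReal} (hH : Measurable H) :
    ∫⁻ z, H (z.1, fun i => V i z.1 + z.2 i) ∂(P.prod (Measure.pi fun _ => gaussianReal 0 v)) =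
      ∫⁻ y, ∫⁻ ω, H (ω, y) * ENNReal.ofReal (∏ i, shiftDensity v (V i ω) (y i)) ∂P
        ∂(Measure.pi fun _ => gaussianReal 0 v) := by
  have hadd : Measurable fun z : Ω × (Fin n → ℝ) => (z.1, fun i => V i z.1 + z.2 i) :=
    measurable_fst.prodMk (measurable_pi_lambda _ fun i =>
      ((hV i).comp measurable_fst).add ((measurable_pi_apply i).comp measurable_snd))
  rw [lintegral_prod (fun z : Ω × (Fin n → ℝ) => H (z.1, fun i => V i z.1 + z.2 i))
      (hH.comp hadd).aemeasurable,
    ← lintegral_lintegral_swap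
      (f := fun ω y => H (ω, y) * ENNReal.ofReal (∏ i, shiftDensity v (V i ω) (y i))) (hH.mul (measurable_prod_shiftDensity v hV)).aemeasurable]
  have hd : ∀ ω, Measurable fun y : Fin n → ℝ =>
      ENNReal.ofReal (∏ i, shiftDensity v (V i ω) (y i)) := fun ω =>
    (continuous_prod_shiftDensity v fun i => V i ω).measurable
  refine lintegral_congr fun ω => ?_
  have hmap : (Measure.pi fun _ : Fin n => gaussianReal 0 v).map (fun e i => V i ω + e i) =
      Measure.pi fun i => gaussianReal (V i ω) v := by
    have := Measure.pi_map_pi (μ := fun _ : Fin n => gaussianReal 0 v)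
      (f := fun i e => V i ω + e) fun i => (measurable_const_add _).aemeasurable
    rw [this]
    congr 1
    ext1 i
    rw [gaussianReal_map_const_add, zero_add]
  have hm1 : Measurable fun (e : Fin n → ℝ) i => V i ω + e i :=
    measurable_pi_lambda _ fun i => (measurable_pi_apply i).const_add _
  have hHω : Measurable fun y => H (ω, y) := hH.comp measurable_prodMk_left
  rw [← lintegral_map (f := fun y => H (ω, y)) hHω hm1, hmap, pi_gaussianReal_eq_withDensity hv,
    lintegral_withDensity_eq_lintegral_mul _ (hd ω) hHω]
  refine lintegral_congr fun y => ?_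
  simp only [Pi.mul_apply]
  rw [mul_comm]

theorem toNNReal_sq_ne_zero {σ : ℝ} (hσ : 0 < σ) : (σ ^ 2).toNNReal ≠ 0 := by
  have : 0 < σ ^ 2 := by positivity
  simpa using this.ne'

/-- Residual of the noisy regression at a fixed design. -/
theorem fixed_design_residual {σ : ℝ} (hσ : 0 < σ) (hfm : ∀ x, Measurable (f x))
    (hG : IsGaussianProcess f P) (h0 : ∀ x, ∫ ω, f x ω ∂P = 0)
    (hcov : ∀ x x', cov[f x, f x'; P] = κ x x') {n : ℕ} (p : Fin n → A) (x : A)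
    {k w : Fin n → ℝ} (hk : k = fun i => κ (p i) x) 
    (hw : w = (gram κ p + σ ^ 2 • (1 : Matrix (Fin n) (Fin n) ℝ))⁻¹ *ᵥ k) :
    IndepFun (fun z : Ω × (Fin n → ℝ) => f x z.1 - ∑ i, w i * (f (p i) z.1 + z.2 i))
      (fun z i => f (p i) z.1 + z.2 i)
      (P.prod (Measure.pi fun _ => gaussianReal 0 (σ ^ 2).toNNReal)) ∧
    (P.prod (Measure.pi fun _ => gaussianReal 0 (σ ^ 2).toNNReal)).map
      (fun z : Ω × (Fin n → ℝ) => f x z.1 - ∑ i, w i * (f (p i) z.1 + z.2 i)) =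
        gaussianReal 0 (κ x x - k ⬝ᵥ w).toNNReal ∧ 0 ≤ κ x x - k ⬝ᵥ w := by
  set v := (σ ^ 2).toNNReal with hv
  set N : Measure (Fin n → ℝ) := Measure.pi fun _ => gaussianReal 0 v with hN
  have hL : ∀ x, MemLp (f x) 2 P := fun x => (hG.hasGaussianLaw_eval x).memLp_two
  have hfst : MeasurePreserving (Prod.fst : Ω × (Fin n → ℝ) → Ω) (P.prod N) P :=
    measurePreserving_fst
  have hsnd : MeasurePreserving (Prod.snd : Ω × (Fin n → ℝ) → Fin n → ℝ) (P.prod N) N :=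
    measurePreserving_snd
  have hev : ∀ i, MeasurePreserving (fun z : Ω × (Fin n → ℝ) => z.2 i) (P.prod N)
      (gaussianReal 0 v) := fun i => (measurePreserving_eval _ i).comp hsnd
  -- joint Gaussianity
  have hV : HasGaussianLaw (fun z : Ω × (Fin n → ℝ) => (f x z.1, fun i => f (p i) z.1))
      (P.prod N) := by
    classical
    let I : Finset A := insert x (Finset.univ.image p)
    have hxI : x ∈ I := Finset.mem_insert_self _ _
    have hpI : ∀ i, p i ∈ I := fun i =>
      Finset.mem_insert_of_mem (Finset.mem_image_of_mem _ (Finset.mem_univ i))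
    let T : (I → ℝ) →L[ℝ] ℝ × (Fin n → ℝ) :=
      (ContinuousLinearMap.proj ⟨x, hxI⟩).prod
        (ContinuousLinearMap.pi fun i => ContinuousLinearMap.proj ⟨p i, hpI i⟩)
    have h1 : HasGaussianLaw (fun ω => (f x ω, fun i => f (p i) ω)) P :=
      (hG.hasGaussianLaw I).map_fun T
    refine ⟨?_⟩
    have h2 : (P.prod N).map (fun z : Ω × (Fin n → ℝ) => (f x z.1, fun i => f (p i) z.1)) =
        P.map (fun ω => (f x ω, fun i => f (p i) ω)) := by
      conv_rhs => rw [← hfst.map_eq]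
      rw [Measure.map_map ((hfm x).prodMk (measurable_pi_lambda _ fun i => hfm (p i)))
        measurable_fst]
      rfl
    rw [h2]
    exact h1.isGaussian_map
  have he : HasGaussianLaw (fun z : Ω × (Fin n → ℝ) => (z.2 ·)) (P.prod N) := by
    have hi : iIndepFun (fun i (e : Fin n → ℝ) => e i) N :=
      iIndepFun_pi (X := fun _ e => e) fun i => aemeasurable_id
    have h1 : HasGaussianLaw (fun e : Fin n → ℝ => (e ·)) N := by
      refine hi.hasGaussianLaw fun i => ⟨?_⟩
      rw [(measurePreserving_eval (fun _ : Fin n => gaussianReal 0 v) i).map_eq]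
      infer_instance
    refine ⟨?_⟩
    change IsGaussian ((P.prod N).map Prod.snd)
    rw [hsnd.map_eq]
    have := h1.isGaussian_map
    rwa [show (fun e : Fin n → ℝ => (e ·)) = id from rfl, Measure.map_id] at this
  have hVe := IndepFun.hasGaussianLaw hV he
    (indepFun_prod ((hfm x).prodMk (measurable_pi_lambda _ fun i => hfm (p i))) measurable_id)
  -- Payoff values and noise are independent Gaussian vectors, hence jointly Gaussian; the
  -- observations are a linear image of the pair.
  let T : (ℝ × (Fin n → ℝ)) × (Fin n → ℝ) →L[ℝ] ℝ × (Fin n → ℝ) :=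
    (ContinuousLinearMap.fst ℝ ℝ _ ∘L ContinuousLinearMap.fst ℝ _ _).prod
      (ContinuousLinearMap.snd ℝ ℝ _ ∘L ContinuousLinearMap.fst ℝ _ _ +
        ContinuousLinearMap.snd ℝ _ _)
  have hUY : HasGaussianLaw (fun z : Ω × (Fin n → ℝ) => (f x z.1, fun i => f (p i) z.1 + z.2 i))
      (P.prod N) := hVe.map_fun T
  -- moments
  have hLf : ∀ x, MemLp (fun z : Ω × (Fin n → ℝ) => f x z.1) 2 (P.prod N) := fun x =>
    (hL x).comp_fst N
  have hLe : ∀ i, MemLp (fun z : Ω × (Fin n → ℝ) => z.2 i) 2 (P.prod N) := fun i =>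
    (he.eval i).memLp_two
  have hcf : ∀ x x', cov[fun z : Ω × (Fin n → ℝ) => f x z.1, fun z => f x' z.1; P.prod N] =
      κ x x' := by
    intro x x'
    rw [← hcov, ← hfst.map_eq, covariance_map_fun (hfm x).aestronglyMeasurable
      (hfm x').aestronglyMeasurable measurable_fst.aemeasurable, hfst.map_eq]
  have hcfe : ∀ x i, cov[fun z : Ω × (Fin n → ℝ) => f x z.1, fun z => z.2 i; P.prod N] = 0 :=
    fun x i => (indepFun_prod (hfm x) (measurable_pi_apply i)).covariance_eq_zero (hLf x) (hLe i)
  have hce : ∀ i j, cov[fun z : Ω × (Fin n → ℝ) => z.2 i, fun z => z.2 j; P.prod N] =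
      (σ ^ 2 • (1 : Matrix (Fin n) (Fin n) ℝ)) i j := by
    intro i j
    by_cases hij : i = j
    · subst hij
      rw [covariance_self (hev i).measurable.aemeasurable]
      have h1 := (hev i).variance_fun_comp (f := id) aemeasurable_id
      simp only [id_eq] at h1
      rw [h1, variance_id_gaussianReal, hv]
      simp [Real.coe_toNNReal _ (sq_nonneg σ)]
    · have hi : iIndepFun (fun i (e : Fin n → ℝ) => e i) N :=
        iIndepFun_pi (X := fun _ e => e) fun i => aemeasurable_id
      have h1 : cov[fun e : Fin n → ℝ => e i, fun e => e j; N] = 0 := by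
        refine (hi.indepFun hij).covariance_eq_zero ?_ ?_
        · exact (memLp_id_gaussianReal 2).comp_measurePreserving
            (measurePreserving_eval (fun _ : Fin n => gaussianReal 0 v) i)
        · exact (memLp_id_gaussianReal 2).comp_measurePreserving
            (measurePreserving_eval (fun _ : Fin n => gaussianReal 0 v) j)
      rw [← hsnd.map_eq, covariance_map_fun (measurable_pi_apply i).aestronglyMeasurable
        (measurable_pi_apply j).aestronglyMeasurable measurable_snd.aemeasurable] at h1
      rw [h1]
      simp [Matrix.one_apply_ne hij]
  have hif : ∀ x, ∫ z : Ω × (Fin n → ℝ), f x z.1 ∂(P.prod N) = 0 := by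
    intro x
    rw [← h0 x]
    conv_rhs => rw [← hfst.map_eq]
    rw [integral_map measurable_fst.aemeasurable (hfm x).aestronglyMeasurable]
  have hie : ∀ i, ∫ z : Ω × (Fin n → ℝ), z.2 i ∂(P.prod N) = 0 := by
    intro i
    have h1 : ∫ y, y ∂(gaussianReal 0 v) = 0 := integral_id_gaussianReal
    rw [← (hev i).map_eq, integral_map (f := fun y => y) (hev i).measurable.aemeasurable
      aestronglyMeasurable_id] at h1
    exact h1
  have hsym : ∀ x x', κ x x' = κ x' x := fun x x' => by
    rw [← hcov, ← hcov, covariance_comm]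
  have key := residual_indepFun_and_law (U := fun z : Ω × (Fin n → ℝ) => f x z.1)
    (Y := fun i z => f (p i) z.1 + z.2 i) hUY (hif x) (fun i => by
      rw [integral_add ((hLf _).integrable (by norm_num)) ((hLe _).integrable (by norm_num)),
        hif, hie, add_zero]) (u := κ x x) (k := k)
    (add_smul_one_posDef (gram_posSemidef hL hcov p) hσ) (hcf x x)
    (fun j => by
      have h1 := covariance_add_right (hLf x) (hLf (p j)) (hLe j)
      refine Eq.trans h1 ?_
      rw [hcf, hcfe, hk, add_zero, hsym])
    (fun i j => by
      have h1 := covariance_add_left (hLf (p i)) (hLe i) ((hLf (p j)).add (hLe j))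
      refine Eq.trans h1 ?_
      rw [covariance_add_right (hLf (p i)) (hLf (p j)) (hLe j),
        covariance_add_right (hLe i) (hLf (p j)) (hLe j), hcf, hcfe, hce,
        covariance_comm, hcfe, add_zero, zero_add]
      rfl)
  rw [← hw] at key
  exact key

theorem gaussianReal_signed_tail_le (v : NNReal) {c : ℝ} (hc : 0 ≤ c) {s : ℝ} (hs : s ^ 2 = 1) :
    gaussianReal 0 v {z | c * √v < s * z} ≤ ENNReal.ofReal (1 / 2 * Real.exp (-c ^ 2 / 2)) := by
  have h := gaussianReal_map_const_mul (μ := 0) (v := v) s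
  have h1 : NNReal.mk (s ^ 2) (sq_nonneg s) = 1 := NNReal.eq hs
  rw [mul_zero, h1, one_mul] at h
  have hS : MeasurableSet {z : ℝ | c * √v < z} := measurableSet_Ioi
  have h2 := gaussianReal_tail_le v hc
  rw [← h, Measure.map_apply (measurable_const_mul s) hS] at h2
  exact h2

/-- Continuity of the marginal likelihood in the targets, by dominated convergence: a convergent
sequence of targets is bounded. -/
theorem tendsto_lintegral_prod_shiftDensity {v : NNReal} {n : ℕ} {V : Fin n → Ω → ℝ}
    (hV : ∀ i, Measurable (V i)) {u : ℕ → Fin n → ℝ} {y : Fin n → ℝ}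
    (huy : Filter.Tendsto u Filter.atTop (nhds y)) :
    Filter.Tendsto (fun j => ∫⁻ ω, ENNReal.ofReal (∏ i, shiftDensity v (V i ω) (u j i)) ∂P)
      Filter.atTop (nhds (∫⁻ ω, ENNReal.ofReal (∏ i, shiftDensity v (V i ω) (y i)) ∂P)) := by
  obtain ⟨K, hK⟩ := (Metric.isBounded_range_of_tendsto u huy).exists_norm_le
  have hm : ∀ y : Fin n → ℝ, Measurable fun ω =>
      ENNReal.ofReal (∏ i, shiftDensity v (V i ω) (y i)) := fun y =>
    measurable_prod_shiftDensity_left v hV y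
  have hle : ∀ j ω, ENNReal.ofReal (∏ i, shiftDensity v (V i ω) (u j i)) ≤
      ENNReal.ofReal (∏ _i : Fin n, Real.exp (K ^ 2 / (2 * v))) := fun j ω =>
    ENNReal.ofReal_le_ofReal <| Finset.prod_le_prod (fun i _ => (shiftDensity_pos _ _ _).le)
      fun i _ => shiftDensity_le v _ ((norm_le_pi_norm (u j) i).trans (hK _ ⟨j, rfl⟩))
  have hb : ∫⁻ _, ENNReal.ofReal (∏ _i : Fin n, Real.exp (K ^ 2 / (2 * v))) ∂P ≠ ⊤ := by
    rw [lintegral_const, measure_univ, mul_one]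
    exact ENNReal.ofReal_ne_top
  generalize ENNReal.ofReal (∏ _i : Fin n, Real.exp (K ^ 2 / (2 * v))) = b at hle hb
  exact tendsto_lintegral_of_dominated_convergence (fun _ => b) (fun j => hm (u j))
    (fun j => Filter.Eventually.of_forall (hle j)) hb (Filter.Eventually.of_forall fun ω =>
      ((continuous_prod_shiftDensity v fun i => V i ω).tendsto y).comp huy)

/-- Tail bound for the residual under the (unnormalized) posterior, for every value of the
targets. -/
theorem fixed_design_tail {σ : ℝ} (hσ : 0 < σ) (hfm : ∀ x, Measurable (f x))
    (hG : IsGaussianProcess f P) (h0 : ∀ x, ∫ ω, f x ω ∂P = 0)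
    (hcov : ∀ x x', cov[f x, f x'; P] = κ x x') {n : ℕ} (p : Fin n → A) (x : A)
    {k w : Fin n → ℝ} (hk : k = fun i => κ (p i) x)
    (hw : w = (gram κ p + σ ^ 2 • (1 : Matrix (Fin n) (Fin n) ℝ))⁻¹ *ᵥ k)
    {s : ℝ} (hs : s ^ 2 = 1) {c : ℝ} (hc : 0 ≤ c) (y : Fin n → ℝ) :
    ∫⁻ ω, {ω | c * √(κ x x - k ⬝ᵥ w) < s * (f x ω - ∑ i, w i * y i)}.indicator
        (fun ω => ENNReal.ofReal (∏ i, shiftDensity (σ ^ 2).toNNReal (f (p i) ω) (y i))) ω ∂P ≤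
      ENNReal.ofReal (1 / 2 * Real.exp (-c ^ 2 / 2)) *
        ∫⁻ ω, ENNReal.ofReal (∏ i, shiftDensity (σ ^ 2).toNNReal (f (p i) ω) (y i)) ∂P := by
  obtain ⟨hind, hlaw, hnn⟩ := fixed_design_residual hσ hfm hG h0 hcov p x hk hw
  have hv0 := toNNReal_sq_ne_zero hσ
  set v := (σ ^ 2).toNNReal with hv
  set N : Measure (Fin n → ℝ) := Measure.pi fun _ => gaussianReal 0 v with hN
  set q := κ x x - k ⬝ᵥ w with hq
  set C := ENNReal.ofReal (1 / 2 * Real.exp (-c ^ 2 / 2)) with hC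
  set lik : Ω → (Fin n → ℝ) → ENNReal := fun ω y =>
    ENNReal.ofReal (∏ i, shiftDensity v (f (p i) ω) (y i)) with hlik
  have hlikm : Measurable (Function.uncurry lik) :=
    measurable_prod_shiftDensity v fun i => hfm (p i)
  let E : Set (Ω × (Fin n → ℝ)) := {z | c * √q < s * (f x z.1 - ∑ i, w i * z.2 i)}
  have hE : MeasurableSet E := by
    refine measurableSet_lt measurable_const ((((hfm x).comp measurable_fst).sub
      (Finset.measurable_fun_sum _ fun i _ => ?_)).const_mul s)
    exact ((measurable_pi_apply i).comp measurable_snd).const_mul _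
  let G : (Fin n → ℝ) → ENNReal := fun y => ∫⁻ ω, E.indicator 1 (ω, y) * lik ω y ∂P
  let Z : (Fin n → ℝ) → ENNReal := fun y => ∫⁻ ω, lik ω y ∂P
  have hGm : Measurable G :=
    ((measurable_one.indicator hE).mul hlikm).lintegral_prod_left'
  have hZm : Measurable Z := hlikm.lintegral_prod_left'
  -- integrated inequality
  have hint : ∀ B : Set (Fin n → ℝ), MeasurableSet B → ∫⁻ y in B, G y ∂N ≤ ∫⁻ y in B, C * Z y ∂N := by
    intro B hB
    have hB' : MeasurableSet {z : Ω × (Fin n → ℝ) | z.2 ∈ B} := measurable_snd hB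
    have e1 := lintegral_add_noise (P := P) hv0 (fun i => hfm (p i))
      (measurable_one.indicator (hE.inter hB'))
    have e2 := lintegral_add_noise (P := P) hv0 (fun i => hfm (p i))
      (measurable_one.indicator hB')
    have hYm : Measurable fun (z : Ω × (Fin n → ℝ)) i => f (p i) z.1 + z.2 i :=
      measurable_pi_lambda _ fun i => ((hfm (p i)).comp measurable_fst).add
        ((measurable_pi_apply i).comp measurable_snd)
    have hRm : Measurable fun z : Ω × (Fin n → ℝ) =>
        f x z.1 - ∑ i, w i * (f (p i) z.1 + z.2 i) :=
      ((hfm x).comp measurable_fst).sub (Finset.measurable_fun_sum _ fun i _ =>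
        (((hfm (p i)).comp measurable_fst).add
          ((measurable_pi_apply i).comp measurable_snd)).const_mul _)
    have hS : MeasurableSet {u : ℝ | c * √q < s * u} :=
      measurableSet_lt measurable_const (measurable_id.const_mul s)
    have l1 : ∀ y, ∫⁻ ω, (E ∩ {z : Ω × (Fin n → ℝ) | z.2 ∈ B}).indicator 1 (ω, y) * lik ω y ∂P =
        B.indicator G y := by
      intro y
      by_cases hy : y ∈ B
      · rw [Set.indicator_of_mem hy]
        refine lintegral_congr fun ω => ?_
        congr 1
        simp [Set.indicator, hy]
      · rw [Set.indicator_of_notMem hy]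
        simp [Set.indicator, hy]
    have l2 : ∀ y, ∫⁻ ω, ({z : Ω × (Fin n → ℝ) | z.2 ∈ B}).indicator 1 (ω, y) * lik ω y ∂P =
        B.indicator Z y := by
      intro y
      by_cases hy : y ∈ B
      · rw [Set.indicator_of_mem hy]
        refine lintegral_congr fun ω => ?_
        simp [Set.indicator, hy]
      · rw [Set.indicator_of_notMem hy]
        simp [Set.indicator, hy]
    have r1 : ∫⁻ y in B, G y ∂N = (P.prod N) ((fun z : Ω × (Fin n → ℝ) =>
        f x z.1 - ∑ i, w i * (f (p i) z.1 + z.2 i)) ⁻¹' {u | c * √q < s * u} ∩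
        (fun z i => f (p i) z.1 + z.2 i) ⁻¹' B) := by
      rw [← lintegral_indicator hB, ← lintegral_congr l1, ← e1, ← lintegral_indicator_one]
      · rfl
      · exact (hRm hS).inter (hYm hB)
    have r2 : ∫⁻ y in B, Z y ∂N =
        (P.prod N) ((fun (z : Ω × (Fin n → ℝ)) i => f (p i) z.1 + z.2 i) ⁻¹' B) := by
      rw [← lintegral_indicator hB, ← lintegral_congr l2, ← e2, ← lintegral_indicator_one]
      · rfl
      · exact hYm hB
    rw [lintegral_const_mul _ hZm, r1, r2, hind.measure_inter_preimage_eq_mul _ _ hS hB]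
    gcongr
    rw [← Measure.map_apply hRm hS, hlaw]
    have hq' : √q = √((q.toNNReal : NNReal) : ℝ) := by rw [Real.coe_toNNReal _ hnn]
    rw [hq']
    exact gaussianReal_signed_tail_le q.toNNReal hc hs
  -- The inequality so far holds only almost everywhere, with a null set depending on the design. In
  -- the adaptive setting the design varies with the targets, so every y is needed; y is approached
  -- by good points, which are dense because Gaussian measure charges open sets.
  have hae : G ≤ᵐ[N] fun y => C * Z y :=
    ae_le_of_forall_setLIntegral_le_of_sigmaFinite hGm fun B hB _ => hint B hB
  have := isOpenPosMeasure_gaussianReal hv0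
  have hdense : Dense {y | G y ≤ C * Z y} := Measure.dense_of_ae hae
  obtain ⟨u, hu, huy⟩ := mem_closure_iff_seq_limit.mp (hdense y)
  have hlikt : ∀ ω, Filter.Tendsto (fun j => lik ω (u j)) Filter.atTop (nhds (lik ω y)) :=
    fun ω => ((continuous_prod_shiftDensity v fun i => f (p i) ω).tendsto y).comp huy
  have hZt : Filter.Tendsto (fun j => C * Z (u j)) Filter.atTop (nhds (C * Z y)) := by
    refine ENNReal.Tendsto.const_mul ?_ (Or.inr ENNReal.ofReal_ne_top)
    exact tendsto_lintegral_prod_shiftDensity (fun i => hfm (p i)) huy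
  have hGe : ∫⁻ ω, {ω | c * √q < s * (f x ω - ∑ i, w i * y i)}.indicator
      (fun ω => lik ω y) ω ∂P = G y := by
    refine lintegral_congr fun ω => ?_
    by_cases h : c * √q < s * (f x ω - ∑ i, w i * y i)
    · simp [Set.indicator, E, h]
    · simp [Set.indicator, E, h]
  rw [hGe]
  -- The deviation is a strict inequality, hence an open condition on the targets; this makes the
  -- integrand lower semicontinuous, and Fatou applies.
  have hfatou : G y ≤ Filter.liminf (fun j => G (u j)) Filter.atTop := by
    refine le_trans (lintegral_mono fun ω => ?_) (lintegral_liminf_le fun j =>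
      ((measurable_one.indicator hE).mul hlikm).comp measurable_prodMk_right)
    by_cases h : (ω, y) ∈ E
    · have hopen : ∀ᶠ j in Filter.atTop, (ω, u j) ∈ E := by
        have hc' : Continuous fun y : Fin n → ℝ => s * (f x ω - ∑ i, w i * y i) := by fun_prop
        exact (hc'.tendsto y |>.comp huy).eventually_const_lt h
      have ht : Filter.Tendsto (fun j => E.indicator 1 (ω, u j) * lik ω (u j)) Filter.atTop
          (nhds (lik ω y)) := by
        refine (hlikt ω).congr' ?_
        filter_upwards [hopen] with j hj
        simp [Set.indicator_of_mem hj]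
      rw [Set.indicator_of_mem h]
      simp only [Pi.one_apply, one_mul]
      exact ht.liminf_eq.ge
    · rw [Set.indicator_of_notMem h]
      simp
  calc G y ≤ Filter.liminf (fun j => G (u j)) Filter.atTop := hfatou
    _ ≤ Filter.liminf (fun j => C * Z (u j)) Filter.atTop :=
        Filter.liminf_le_liminf (Filter.Eventually.of_forall hu)
    _ = C * Z y := hZt.liminf_eq

/-- The regression weights give the posterior mean because the inverse regularized Gram matrix is
symmetric and may be moved across the dot product. -/
theorem posterior_tail {σ : ℝ} (hσ : 0 < σ) (hfm : ∀ x, Measurable (f x))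
    (hG : IsGaussianProcess f P) (h0 : ∀ x, ∫ ω, f x ω ∂P = 0)
    (hcov : ∀ x x', cov[f x, f x'; P] = κ x x') (D : Data A) (x : A)
    {s : ℝ} (hs : s ^ 2 = 1) {c : ℝ} (hc : 0 ≤ c) :
    ∫⁻ ω, {ω | c * √(postVar κ σ D x) < s * (f x ω - postMean κ σ D x)}.indicator
        (fun ω => ENNReal.ofReal (likelihood (σ ^ 2).toNNReal (fun x => f x ω) D)) ω ∂P ≤
      ENNReal.ofReal (1 / 2 * Real.exp (-c ^ 2 / 2)) *
        ∫⁻ ω, ENNReal.ofReal (likelihood (σ ^ 2).toNNReal (fun x => f x ω) D) ∂P := by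
  have h := fixed_design_tail hσ hfm hG h0 hcov D.points x (k := kvec κ D x) rfl rfl hs hc
    D.targets
  have hmean : postMean κ σ D x = ∑ i, ((regGram κ σ D)⁻¹ *ᵥ kvec κ D x) i * D.targets i := by
    have hL : ∀ x, MemLp (f x) 2 P := fun x => (hG.hasGaussianLaw_eval x).memLp_two
    have hM : (regGram κ σ D).PosDef :=
      add_smul_one_posDef (gram_posSemidef hL hcov D.points) hσ
    have hsym : ((regGram κ σ D)⁻¹)ᵀ = (regGram κ σ D)⁻¹ := by
      have := hM.inv.isHermitian
      rwa [Matrix.IsHermitian, Matrix.conjTranspose_eq_transpose_of_trivial] at this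
    change kvec κ D x ⬝ᵥ ((regGram κ σ D)⁻¹ *ᵥ D.targets) =
      ((regGram κ σ D)⁻¹ *ᵥ kvec κ D x) ⬝ᵥ D.targets
    rw [Matrix.dotProduct_mulVec, ← Matrix.mulVec_transpose, hsym]
  rw [hmean]
  exact h

/-- The posterior variance is nonnegative. -/
theorem postVar_nonneg {σ : ℝ} (hσ : 0 < σ) (hfm : ∀ x, Measurable (f x))
    (hG : IsGaussianProcess f P) (h0 : ∀ x, ∫ ω, f x ω ∂P = 0)
    (hcov : ∀ x x', cov[f x, f x'; P] = κ x x') (D : Data A) (x : A) : 0 ≤ postVar κ σ D x :=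
  (fixed_design_residual hσ hfm hG h0 hcov D.points x (k := kvec κ D x) rfl rfl).2.2

end FixedDesign

theorem likelihood_snoc {A : Type*} (v : NNReal) (g : A → ℝ) (D : Data A) (x : A) (y : ℝ) :
    likelihood v g (D.snoc (x, y)) = likelihood v g D * shiftDensity v (g x) y := by
  have h : likelihood v g (D.snoc (x, y)) = ∏ i : Fin (D.1 + 1), shiftDensity v
      (g (Fin.snoc (α := fun _ => A × ℝ) D.2 (x, y) i).1)
      (Fin.snoc (α := fun _ => A × ℝ) D.2 (x, y) i).2 := rfl
  rw [h, Fin.prod_univ_castSucc]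
  simp only [Fin.snoc_castSucc, Fin.snoc_last]
  rfl

theorem likelihood_nonneg {A : Type*} (v : NNReal) (g : A → ℝ) (D : Data A) : 0 ≤ likelihood v g D :=
  Finset.prod_nonneg fun _ _ => (shiftDensity_pos _ _ _).le

/-! ### Adaptive data by change of measure. -/

section ChangeOfMeasure

variable {A : Type*} [MeasurableSpace A] {κ : A → A → ℝ}

theorem measurable_likelihood (v : NNReal) {G : Type*} [MeasurableSpace G] {ev : G → A → ℝ}
    (hev : Measurable (Function.uncurry ev)) :
    Measurable fun p : G × Data A => ENNReal.ofReal (likelihood v (ev p.1) p.2) := by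
  refine Measurable.ennreal_ofReal (measurable_prod_sigma fun n => ?_)
  change Measurable fun p : G × (Fin n → A × ℝ) =>
    ∏ i : Fin n, shiftDensity v (ev p.1 (p.2 i).1) (p.2 i).2
  refine Finset.measurable_fun_prod _ fun i _ => ?_
  have h : Measurable fun p : G × (Fin n → A × ℝ) => p.2 i :=
    (measurable_pi_apply i).comp measurable_snd
  exact (continuous_shiftDensity v).measurable.comp
    ((hev.comp (measurable_fst.prodMk h.fst)).prodMk h.snd)

variable {Ω : Type*} [MeasurableSpace Ω] {P : Measure Ω} {η : ℕ → Ω → ℝ} {v : NNReal} {σ ε : ℝ}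
  {rule : ℕ → Data A → A} {g : A → ℝ}

/-- For a fixed payoff, the data after t iterations are a function of the noise at times 1, …, t
only. -/
theorem indepFun_run_noise (hκ : Measurable (Function.uncurry κ)) (hr : ∀ t, Measurable (rule t))
    (hg : Measurable g) (hηm : ∀ t, Measurable (η t)) (hind : iIndepFun η P) (t : ℕ) :
    IndepFun (fun ω => run κ σ ε rule g (fun s => η s ω) t) (η (t + 1)) P := by
  classical
  have h := hind.indepFun_finset (Finset.Icc 1 t) {t + 1} (by simp) hηm
  -- Noise outside 1, …, t is set to 0; by `run_congr` this value is never read.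
  let ext : (Finset.Icc 1 t → ℝ) → ℕ → ℝ := fun z s =>
    if hs : s ∈ Finset.Icc 1 t then z ⟨s, hs⟩ else 0
  have hext : ∀ s, Measurable fun z => ext z s := by
    intro s
    by_cases hs : s ∈ Finset.Icc 1 t
    · simp only [ext, hs, dif_pos]
      exact measurable_pi_apply _
    · simp only [ext, hs, dif_neg, not_false_iff]
      exact measurable_const
  have hφ : Measurable fun z => run κ σ ε rule g (ext z) t :=
    measurable_run σ hκ ε hr (g := fun _ => g) (hg.comp measurable_snd) hext t
  have h2 := h.comp hφ (measurable_pi_apply (⟨t + 1, by simp⟩ : ({t + 1} : Finset ℕ)))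
  have e : (fun ω => run κ σ ε rule g (fun s => η s ω) t) =
      (fun z => run κ σ ε rule g (ext z) t) ∘ fun a i => η (↑i) a := by
    ext1 ω
    refine run_congr κ σ ε rule g fun s hs => ?_
    simp [ext, Finset.mem_Icc.mp hs]
  rw [e]
  exact h2

variable [IsProbabilityMeasure P]

theorem lintegral_run_succ (hκ : Measurable (Function.uncurry κ)) (hr : ∀ t, Measurable (rule t))
    (hg : Measurable g) (hηm : ∀ t, Measurable (η t))
    (hηl : ∀ t, P.map (η t) = gaussianReal 0 v) (hind : iIndepFun η P) (t : ℕ)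
    {Φ : Data A → ENNReal} (hΦ : Measurable Φ) :
    ∫⁻ ω, Φ (run κ σ ε rule g (fun s => η s ω) (t + 1)) ∂P =
      ∫⁻ ω, ∫⁻ e, Φ (step κ σ ε rule g (t + 1) (run κ σ ε rule g (fun s => η s ω) t) e)
        ∂(gaussianReal 0 v) ∂P := by
  have hrun : Measurable fun ω => run κ σ ε rule g (fun s => η s ω) t :=
    measurable_run σ hκ ε hr (g := fun _ => g) (hg.comp measurable_snd) hηm t
  have hstep : Measurable fun p : Data A × ℝ => Φ (step κ σ ε rule g (t + 1) p.1 p.2) :=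
    hΦ.comp (measurable_step σ hκ ε (hr _) (g := fun _ => g) (hg.comp measurable_snd)
      measurable_fst measurable_snd)
  have h := (indepFun_iff_map_prod_eq_prod_map_map hrun.aemeasurable
    (hηm (t + 1)).aemeasurable).mp (indepFun_run_noise (σ := σ) (ε := ε) hκ hr hg hηm hind t)
  have e1 : ∫⁻ ω, Φ (run κ σ ε rule g (fun s => η s ω) (t + 1)) ∂P =
      ∫⁻ p, Φ (step κ σ ε rule g (t + 1) p.1 p.2)
        ∂(P.map fun ω => (run κ σ ε rule g (fun s => η s ω) t, η (t + 1) ω)) :=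
    (lintegral_map hstep (hrun.prodMk (hηm _))).symm
  have : IsProbabilityMeasure (P.map fun ω => run κ σ ε rule g (fun s => η s ω) t) :=
    Measure.isProbabilityMeasure_map hrun.aemeasurable
  rw [e1, h, hηl, lintegral_prod _ hstep.aemeasurable]
  exact lintegral_map hstep.lintegral_prod_right' hrun

/-- Change of measure: the law of the data collected on the payoff `g` has the likelihood of `g` as
its density with respect to the law of the data collected on the zero payoff. -/
theorem lintegral_run_eq (hv : v ≠ 0) (hκ : Measurable (Function.uncurry κ))
    (hr : ∀ t, Measurable (rule t))
    (hg : Measurable g) (hηm : ∀ t, Measurable (η t))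
    (hηl : ∀ t, P.map (η t) = gaussianReal 0 v) (hind : iIndepFun η P) (t : ℕ)
    {Φ : Data A → ENNReal} (hΦ : Measurable Φ) :
    ∫⁻ ω, Φ (run κ σ ε rule g (fun s => η s ω) t) ∂P =
      ∫⁻ ω, Φ (run κ σ ε rule 0 (fun s => η s ω) t) *
        ENNReal.ofReal (likelihood v g (run κ σ ε rule 0 (fun s => η s ω) t)) ∂P := by
  have hlik : Measurable fun D : Data A => ENNReal.ofReal (likelihood v g D) :=
    (measurable_likelihood v (ev := fun _ : Unit => g) (hg.comp measurable_snd)).comp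
      ((measurable_const (a := ())).prodMk measurable_id)
  induction t generalizing Φ with
  | zero =>
    refine lintegral_congr fun ω => ?_
    have : likelihood v g (run κ σ ε rule 0 (fun s => η s ω) 0) = 1 :=
      Fin.prod_univ_zero _
    rw [this, ENNReal.ofReal_one, mul_one]
    rfl
  | succ t ih =>
    have hstep : Measurable fun p : Data A × ℝ => Φ (step κ σ ε rule g (t + 1) p.1 p.2) :=
      hΦ.comp (measurable_step σ hκ ε (hr _) (g := fun _ => g) (hg.comp measurable_snd)
        measurable_fst measurable_snd)
    rw [lintegral_run_succ hκ hr hg hηm hηl hind t hΦ,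
      ih (Φ := fun D => ∫⁻ e, Φ (step κ σ ε rule g (t + 1) D e) ∂(gaussianReal 0 v))
        hstep.lintegral_prod_right',
      lintegral_run_succ (g := 0) (Φ := fun D => Φ D * ENNReal.ofReal (likelihood v g D))
        hκ hr measurable_const hηm hηl hind t (hΦ.mul hlik)]
    refine lintegral_congr fun ω => ?_
    generalize run κ σ ε rule 0 (fun s => η s ω) t = D
    -- Whether to sample, and where, depends on D alone, so both payoffs take the same branch. On
    -- sampling, shifting the noise by g(x) contributes exactly the new likelihood factor.
    by_cases hD : ε < condEntropy κ σ D (rule (t + 1) D)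
    · simp only [step, hD, if_true, Pi.zero_apply, zero_add]
      set x := rule (t + 1) D with hx
      have hsn : Measurable fun y : ℝ => Φ (D.snoc (x, y)) :=
        hΦ.comp (measurable_snoc.comp
          ((measurable_const.prodMk measurable_id).prodMk measurable_const))
      have hsd : Measurable fun y : ℝ => ENNReal.ofReal (shiftDensity v (g x) y) :=
        ((continuous_shiftDensity v).comp
          (by fun_prop : Continuous fun y : ℝ => (g x, y))).measurable.ennreal_ofReal
      have hmap := gaussianReal_map_const_add (μ := 0) (v := v) (g x)
      rw [zero_add] at hmap
      rw [← lintegral_map (f := fun y => Φ (D.snoc (x, y))) hsn (measurable_const_add _), hmap,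
        gaussianReal_eq_withDensity_shiftDensity hv,
        lintegral_withDensity_eq_lintegral_mul _ hsd hsn, ← lintegral_mul_const _ (hsd.mul hsn)]
      refine lintegral_congr fun y => ?_
      simp only [Pi.mul_apply]
      rw [likelihood_snoc, ENNReal.ofReal_mul (likelihood_nonneg _ _ _)]
      ring
    · simp [step, hD]

/-- Under the Gaussian process prior, and for adaptively collected data, the deviation of the payoff
from the posterior mean at a point chosen from the data has a Gaussian tail. -/
theorem adaptive_tail {G : Type*} [MeasurableSpace G] {μ : Measure G} [IsProbabilityMeasure μ]
    {ev : G → A → ℝ} (hev : Measurable (Function.uncurry ev)) (hσ : 0 < σ)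
    (hG : IsGaussianProcess (fun x g => ev g x) μ) (h0 : ∀ x, ∫ g, ev g x ∂μ = 0)
    (hcov : ∀ x x', cov[fun g => ev g x, fun g => ev g x'; μ] = κ x x')
    (hκ : Measurable (Function.uncurry κ)) (hr : ∀ t, Measurable (rule t))
    (hηm : ∀ t, Measurable (η t))
    (hηl : ∀ t, P.map (η t) = gaussianReal 0 (σ ^ 2).toNNReal) (hind : iIndepFun η P) (t : ℕ)
    {ξ : Data A → A} (hξ : Measurable ξ) {s : ℝ} (hs : s ^ 2 = 1) {c : ℝ} (hc : 0 ≤ c) :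
    (μ.prod P) ((fun p : G × Ω => (p.1, run κ σ ε rule (ev p.1) (fun s => η s p.2) t)) ⁻¹'
      {q : G × Data A | c * √(postVar κ σ q.2 (ξ q.2)) <
        s * (ev q.1 (ξ q.2) - postMean κ σ q.2 (ξ q.2))}) ≤
      ENNReal.ofReal (1 / 2 * Real.exp (-c ^ 2 / 2)) := by
  set v := (σ ^ 2).toNNReal with hv
  have hv0 : v ≠ 0 := toNNReal_sq_ne_zero hσ
  set E : Set (G × Data A) := {q | c * √(postVar κ σ q.2 (ξ q.2)) <
        s * (ev q.1 (ξ q.2) - postMean κ σ q.2 (ξ q.2))} with hE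
  have hξ2 : Measurable fun q : G × Data A => (ξ q.2, q.2) :=
    (hξ.comp measurable_snd).prodMk measurable_snd
  have hEm : MeasurableSet E := by
    refine measurableSet_lt ?_ ?_
    · exact ((Real.continuous_sqrt.measurable.comp
        ((measurable_postVar σ hκ).comp hξ2))).const_mul c
    · exact ((hev.comp (measurable_fst.prodMk (hξ.comp measurable_snd))).sub
        ((measurable_postMean σ hκ).comp hξ2)).const_mul s
  have hrun : Measurable fun p : G × Ω =>
      (p.1, run κ σ ε rule (ev p.1) (fun s => η s p.2) t) :=
    measurable_fst.prodMk (measurable_run σ hκ ε hr (g := fun p : G × Ω => ev p.1)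
      (hev.comp ((measurable_fst.comp measurable_fst).prodMk measurable_snd))
      (fun s => (hηm s).comp measurable_snd) t)
  have hrun0 : Measurable fun ω => run κ σ ε rule 0 (fun s => η s ω) t :=
    measurable_run σ hκ ε hr (g := fun _ => 0) measurable_const hηm t
  have hgm : ∀ g, Measurable (ev g) := fun g => hev.comp measurable_prodMk_left
  have hlik := measurable_likelihood v hev
  have hlik0 : Measurable fun p : G × Ω =>
      ENNReal.ofReal (likelihood v (ev p.1) (run κ σ ε rule 0 (fun s => η s p.2) t)) :=
    hlik.comp (measurable_fst.prodMk (hrun0.comp measurable_snd))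
  have hEi : Measurable (E.indicator (1 : G × Data A → ENNReal)) := measurable_one.indicator hEm
  have hEi0 : Measurable fun p : G × Ω =>
      E.indicator (1 : G × Data A → ENNReal) (p.1, run κ σ ε rule 0 (fun s => η s p.2) t) :=
    hEi.comp (measurable_fst.prodMk (hrun0.comp measurable_snd))
  have e0 : (μ.prod P) ((fun p : G × Ω =>
      (p.1, run κ σ ε rule (ev p.1) (fun s => η s p.2) t)) ⁻¹' E) =
      ∫⁻ g, ∫⁻ ω, E.indicator 1 (g, run κ σ ε rule (ev g) (fun s => η s ω) t) ∂P ∂μ := by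
    rw [← lintegral_indicator_one (hrun hEm)]
    exact lintegral_prod _ (hEi.comp hrun).aemeasurable
  have e1 : ∀ g, ∫⁻ ω, E.indicator 1 (g, run κ σ ε rule (ev g) (fun s => η s ω) t) ∂P =
      ∫⁻ ω, E.indicator 1 (g, run κ σ ε rule 0 (fun s => η s ω) t) *
        ENNReal.ofReal (likelihood v (ev g) (run κ σ ε rule 0 (fun s => η s ω) t)) ∂P :=
    fun g => lintegral_run_eq (Φ := fun D => E.indicator 1 (g, D)) hv0 hκ hr (hgm g) hηm hηl hind t
      (hEi.comp measurable_prodMk_left)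
  -- The likelihood has total mass one: change of measure applied to the constant function 1.
  have e2 : ∀ g, ∫⁻ ω, ENNReal.ofReal
      (likelihood v (ev g) (run κ σ ε rule 0 (fun s => η s ω) t)) ∂P = 1 := by
    intro g
    have h := lintegral_run_eq (σ := σ) (ε := ε) (Φ := fun _ => 1) hv0 hκ hr (hgm g) hηm hηl hind t
      measurable_const
    simp only [lintegral_const, measure_univ, one_mul] at h
    exact h.symm
  set C := ENNReal.ofReal (1 / 2 * Real.exp (-c ^ 2 / 2)) with hC
  rw [e0]
  simp_rw [e1]
  -- After the change of measure the data no longer involve g. With the payoff integral inside, D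
  -- and hence ξ D are constants there, and the fixed-design bound applies.
  rw [lintegral_lintegral_swap (hEi0.mul hlik0).aemeasurable]
  calc ∫⁻ ω, ∫⁻ g, E.indicator 1 (g, run κ σ ε rule 0 (fun s => η s ω) t) *
        ENNReal.ofReal (likelihood v (ev g) (run κ σ ε rule 0 (fun s => η s ω) t)) ∂μ ∂P
      ≤ ∫⁻ ω, C * ∫⁻ g, ENNReal.ofReal
          (likelihood v (ev g) (run κ σ ε rule 0 (fun s => η s ω) t)) ∂μ ∂P := by
        refine lintegral_mono fun ω => ?_
        generalize run κ σ ε rule 0 (fun s => η s ω) t = D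
        refine le_trans (le_of_eq ?_) (posterior_tail (f := fun x g => ev g x) hσ
          (fun x => hev.comp measurable_prodMk_right) hG h0 hcov D (ξ D) hs hc)
        refine lintegral_congr fun g => ?_
        by_cases h : (g, D) ∈ E
        · rw [Set.indicator_of_mem h, Set.indicator_of_mem (by exact h)]
          simp [hv]
        · rw [Set.indicator_of_notMem h, Set.indicator_of_notMem (by exact h), zero_mul]
    _ = C * ∫⁻ g, ∫⁻ ω, ENNReal.ofReal
          (likelihood v (ev g) (run κ σ ε rule 0 (fun s => η s ω) t)) ∂P ∂μ := by
        rw [lintegral_const_mul _ hlik0.lintegral_prod_left',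
          ← lintegral_lintegral_swap (f := fun g ω => ENNReal.ofReal
            (likelihood v (ev g) (run κ σ ε rule 0 (fun s => η s ω) t))) hlik0.aemeasurable]
    _ = C := by
        simp_rw [e2]
        simp

end ChangeOfMeasure

/-! ### Confidence bounds on the original probability space. -/

section Confidence

variable {A : Type*} [TopologicalSpace A] [TopologicalSpace.MetrizableSpace A]
  [SecondCountableTopology A] [MeasurableSpace A] [BorelSpace A]

/-- Joint measurability of evaluation is the reason for passing to continuous paths: it fails to be
available on the space of all functions with its product σ-algebra when the domain is uncountable.
-/
theorem measurable_eval_continuous :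
    Measurable (Function.uncurry fun (g : {g : A → ℝ // Continuous g}) (x : A) => g.1 x) := by
  have h : Measurable (Function.uncurry fun (x : A) (g : {g : A → ℝ // Continuous g}) => g.1 x) :=
    measurable_uncurry_of_continuous_of_measurable (fun g => g.2) fun x =>
      (measurable_pi_apply x).comp measurable_subtype_coe
  exact h.comp measurable_swap

variable {Ω : Type*} [MeasurableSpace Ω] {P : Measure Ω} [IsProbabilityMeasure P]
  {κ : A → A → ℝ} {σ : ℝ} {f : A → Ω → ℝ} {η : ℕ → Ω → ℝ}

/-- With zero means, κ(x, x') is the integral of f(x) f(x'), and continuous paths make f jointly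
measurable. -/
theorem measurable_kernel (hfm : ∀ x, Measurable (f x)) (hfc : ∀ ω, Continuous fun x => f x ω)
    (h0 : ∀ x, ∫ ω, f x ω ∂P = 0) (hcov : ∀ x x', cov[f x, f x'; P] = κ x x') :
    Measurable (Function.uncurry κ) := by
  have hf : Measurable (Function.uncurry f) :=
    measurable_uncurry_of_continuous_of_measurable hfc hfm
  have e : Function.uncurry κ = fun p : A × A => ∫ ω, f p.1 ω * f p.2 ω ∂P := by
    ext ⟨x, x'⟩
    simp only [Function.uncurry_apply_pair]
    rw [← hcov, covariance]
    simp only [h0, sub_zero]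
  rw [e]
  have hm : Measurable fun q : (A × A) × Ω => f q.1.1 q.2 * f q.1.2 q.2 :=
    (hf.comp ((measurable_fst.comp measurable_fst).prodMk measurable_snd)).mul
      (hf.comp ((measurable_snd.comp measurable_fst).prodMk measurable_snd))
  exact (hm.stronglyMeasurable.integral_prod_right
    (f := fun (p : A × A) ω => f p.1 ω * f p.2 ω)).measurable

/-- Confidence bound at a point chosen from the data collected by the algorithm. -/
theorem confidence_tail (hσ : 0 < σ) (hM : IsGPModel P κ σ f η)
    (hfc : ∀ ω, Continuous fun x => f x ω) {ε : ℝ} {rule : ℕ → Data A → A}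
    (hr : ∀ t, Measurable (rule t)) (t : ℕ) {ξ : Data A → A} (hξ : Measurable ξ)
    {s : ℝ} (hs : s ^ 2 = 1) {c : ℝ} (hc : 0 ≤ c) :
    P {ω | c * √(postVar κ σ (run κ σ ε rule (fun x => f x ω) (fun s => η s ω) t)
        (ξ (run κ σ ε rule (fun x => f x ω) (fun s => η s ω) t))) <
      s * (f (ξ (run κ σ ε rule (fun x => f x ω) (fun s => η s ω) t)) ω -
        postMean κ σ (run κ σ ε rule (fun x => f x ω) (fun s => η s ω) t)
          (ξ (run κ σ ε rule (fun x => f x ω) (fun s => η s ω) t)))} ≤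
      ENNReal.ofReal (1 / 2 * Real.exp (-c ^ 2 / 2)) := by
  have hκ := measurable_kernel hM.measurable_payoff hfc hM.mean_zero hM.covariance_eq
  let F : Ω → {g : A → ℝ // Continuous g} := fun ω => ⟨fun x => f x ω, hfc ω⟩
  let H : Ω → ℕ → ℝ := fun ω t => η t ω
  have hF : Measurable F :=
    (measurable_pi_lambda _ fun x => hM.measurable_payoff x).subtype_mk
  have hH : Measurable H := measurable_pi_lambda _ fun t => hM.measurable_noise t
  set μ := P.map F with hμ
  have : IsProbabilityMeasure μ := Measure.isProbabilityMeasure_map hF.aemeasurable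
  have hevx : ∀ x, Measurable fun g : {g : A → ℝ // Continuous g} => g.1 x := fun x =>
    (measurable_pi_apply x).comp measurable_subtype_coe
  -- The σ-algebra on continuous functions is induced from the product one, so F and the raw path
  -- generate the same σ-algebra on Ω.
  have hind : IndepFun F H P := by
    have h := hM.indep
    have e : MeasurableSpace.comap F inferInstance =
        MeasurableSpace.comap (fun ω x => f x ω) inferInstance := by
      change MeasurableSpace.comap F (MeasurableSpace.comap Subtype.val _) = _
      rw [MeasurableSpace.comap_comp]
      rfl
    rw [IndepFun_iff_Indep] at h ⊢
    rwa [e]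
  -- Independence allows payoff and noise to be drawn from separate factors, as `adaptive_tail`
  -- requires.
  have hlaw : P.map (fun ω => (F ω, H ω)) = (μ.prod P).map (Prod.map id H) := by
    rw [(indepFun_iff_map_prod_eq_prod_map_map hF.aemeasurable hH.aemeasurable).mp hind,
      ← Measure.map_prod_map _ _ measurable_id hH, Measure.map_id]
  have hG : IsGaussianProcess (fun x (g : {g : A → ℝ // Continuous g}) => g.1 x) μ := by
    refine ⟨fun I => ⟨?_⟩⟩
    have hm : Measurable fun g : {g : A → ℝ // Continuous g} => I.restrict fun x => g.1 x :=
      measurable_pi_lambda _ fun i => hevx i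
    rw [hμ, Measure.map_map hm hF]
    exact (hM.gaussian.hasGaussianLaw I).isGaussian_map
  have h0 : ∀ x, ∫ g : {g : A → ℝ // Continuous g}, g.1 x ∂μ = 0 := by
    intro x
    rw [hμ, integral_map hF.aemeasurable (hevx x).aestronglyMeasurable]
    exact hM.mean_zero x
  have hcov : ∀ x x', cov[fun g : {g : A → ℝ // Continuous g} => g.1 x, fun g => g.1 x'; μ] =
      κ x x' := by
    intro x x'
    rw [hμ, covariance_map_fun (hevx x).aestronglyMeasurable (hevx x').aestronglyMeasurable
      hF.aemeasurable]
    exact hM.covariance_eq x x'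
  have key := adaptive_tail (ε := ε) (measurable_eval_continuous (A := A)) hσ hG h0 hcov hκ hr
    hM.measurable_noise hM.noise_law hM.noise_indep t hξ hs hc
  refine le_trans (le_of_eq ?_) key
  let R : {g : A → ℝ // Continuous g} × (ℕ → ℝ) → {g : A → ℝ // Continuous g} × Data A :=
    fun p => (p.1, run κ σ ε rule p.1.1 p.2 t)
  have hR : Measurable R :=
    measurable_fst.prodMk (measurable_run σ hκ ε hr
      (g := fun p : {g : A → ℝ // Continuous g} × (ℕ → ℝ) => p.1.1)
      (measurable_eval_continuous.comp
        ((measurable_fst.comp measurable_fst).prodMk measurable_snd))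
      (fun s => (measurable_pi_apply s).comp measurable_snd) t)
  have hE : MeasurableSet {q : {g : A → ℝ // Continuous g} × Data A |
      c * √(postVar κ σ q.2 (ξ q.2)) < s * (q.1.1 (ξ q.2) - postMean κ σ q.2 (ξ q.2))} := by
    have hξ2 : Measurable fun q : {g : A → ℝ // Continuous g} × Data A => (ξ q.2, q.2) :=
      (hξ.comp measurable_snd).prodMk measurable_snd
    refine measurableSet_lt ?_ ?_
    · exact ((Real.continuous_sqrt.measurable.comp
        ((measurable_postVar σ hκ).comp hξ2))).const_mul c
    · exact ((measurable_eval_continuous.comp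
        (measurable_fst.prodMk (hξ.comp measurable_snd))).sub
        ((measurable_postMean σ hκ).comp hξ2)).const_mul s
  have h1 := Measure.map_apply (μ := P) (hF.prodMk hH) (hR hE)
  rw [hlaw, Measure.map_apply (measurable_id.prodMap hH) (hR hE)] at h1
  exact h1.symm

end Confidence

/-! ### Information gain and the sum of posterior variances. -/

section InformationGain

variable {A : Type*} {κ : A → A → ℝ} {σ : ℝ}

/-- Schur complement of the last diagonal entry in the bordered Gram matrix. -/
theorem det_gram_extend (hsym : ∀ x x', κ x x' = κ x' x) (D : Data A) (x : A)
    (hM : (regGram κ σ D).PosDef) {q : Fin (D.1 + 1) → A} (hc : ∀ i, q (Fin.castSucc i) = D.points i)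
    (hl : q (Fin.last D.1) = x) :
    (gram κ q + σ ^ 2 • (1 : Matrix (Fin (D.1 + 1)) (Fin (D.1 + 1)) ℝ)).det =
      (regGram κ σ D).det * (σ ^ 2 + postVar κ σ D x) := by
  have hdet : IsUnit (regGram κ σ D).det := hM.det_pos.ne'.isUnit
  let _ : Invertible (regGram κ σ D) := Matrix.invertibleOfIsUnitDet _ hdet
  have hr : ∀ i j, (gram κ q + σ ^ 2 • (1 : Matrix (Fin (D.1 + 1)) (Fin (D.1 + 1)) ℝ)) i j =
      κ (q i) (q j) + σ ^ 2 * (if i = j then 1 else 0) := fun i j => by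
    simp [gram, Matrix.one_apply]
  have hl' : ∀ j : Fin 1, finSumFinEquiv (Sum.inr j) = Fin.last D.1 := fun j => by
    ext
    simp
  have hc' : ∀ j : Fin D.1, finSumFinEquiv (n := 1) (Sum.inl j) = j.castSucc := fun j => rfl
  have hblock : (gram κ q + σ ^ 2 • (1 : Matrix (Fin (D.1 + 1)) (Fin (D.1 + 1)) ℝ)).submatrix
      (finSumFinEquiv (m := D.1) (n := 1)) (finSumFinEquiv (m := D.1) (n := 1)) =
      Matrix.fromBlocks (regGram κ σ D) (Matrix.of fun i (_ : Fin 1) => kvec κ D x i)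
        (Matrix.of fun (_ : Fin 1) j => kvec κ D x j) (Matrix.of fun _ _ => κ x x + σ ^ 2) := by
    ext i j
    rw [Matrix.submatrix_apply, hr]
    rcases i with i | i <;> rcases j with j | j
    · rw [hc', hc', hc, hc]
      simp [regGram, gram, Matrix.one_apply, Fin.ext_iff]
    · rw [hc', hl', hc, hl, if_neg (Fin.castSucc_lt_last i).ne]
      simp [kvec]
    · rw [hc', hl', hc, hl, if_neg (Fin.castSucc_lt_last j).ne']
      simp [kvec, hsym x]
    · rw [hl', hl', hl]
      simp
  rw [← Matrix.det_submatrix_equiv_self (finSumFinEquiv (m := D.1) (n := 1)), hblock,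
    Matrix.det_fromBlocks₁₁, Matrix.det_fin_one, Matrix.invOf_eq_nonsing_inv]
  congr 1
  have h2 : (Matrix.of (fun (_ : Fin 1) j => kvec κ D x j) * (regGram κ σ D)⁻¹ *
      Matrix.of fun i (_ : Fin 1) => kvec κ D x i) 0 0 =
      kvec κ D x ⬝ᵥ ((regGram κ σ D)⁻¹ *ᵥ kvec κ D x) := by
    rw [Matrix.mul_assoc, Matrix.mul_apply]
    rfl
  rw [Matrix.sub_apply, h2, Matrix.of_apply, postVar]
  ring

theorem det_regGram_snoc (hsym : ∀ x x', κ x x' = κ x' x) (D : Data A) (x : A) (y : ℝ)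
    (hM : (regGram κ σ D).PosDef) :
    (regGram κ σ (D.snoc (x, y))).det = (regGram κ σ D).det * (σ ^ 2 + postVar κ σ D x) := by
  refine det_gram_extend hsym D x hM (q := fun i => (D.snoc (x, y)).points i) (fun i => ?_) ?_
  · change (Fin.snoc (α := fun _ => A × ℝ) D.2 (x, y) i.castSucc).1 = _
    rw [Fin.snoc_castSucc]
    rfl
  · change (Fin.snoc (α := fun _ => A × ℝ) D.2 (x, y) (Fin.last D.1)).1 = _
    rw [Fin.snoc_last]

theorem infoGain_eq (hσ : 0 < σ) {n : ℕ} (p : Fin n → A)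
    (hM : (gram κ p + σ ^ 2 • (1 : Matrix (Fin n) (Fin n) ℝ)).PosDef) :
    infoGain κ σ p = 1 / 2 * (Real.log
      (gram κ p + σ ^ 2 • (1 : Matrix (Fin n) (Fin n) ℝ)).det - n * Real.log (σ ^ 2)) := by
  have hc : (0 : ℝ) < (2 * Real.pi * Real.exp 1) ^ n := by positivity
  have hs : (0 : ℝ) < (σ ^ 2) ^ n := by positivity
  simp only [infoGain, gaussianEntropy, Matrix.det_smul, Fintype.card_fin, Matrix.det_one, mul_one]
  rw [Real.log_mul hc.ne' hM.det_pos.ne', Real.log_mul hc.ne' hs.ne',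
    Real.log_pow (σ ^ 2) n]
  ring

/-- Chain rule for the information gain, obtained by taking logarithms in the determinant recursion.
-/
theorem infoGain_snoc (hσ : 0 < σ) (hsym : ∀ x x', κ x x' = κ x' x)
    (hpsd : ∀ D : Data A, (regGram κ σ D).PosDef) (hpv : ∀ D x, 0 ≤ postVar κ σ D x)
    (D : Data A) (x : A) (y : ℝ) :
    infoGain κ σ (D.snoc (x, y)).points =
      infoGain κ σ D.points + 1 / 2 * Real.log (1 + (σ ^ 2)⁻¹ * postVar κ σ D x) := by
  have h1 := infoGain_eq hσ _ (hpsd (D.snoc (x, y)))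
  have h2 := infoGain_eq hσ _ (hpsd D)
  have h3 : (0 : ℝ) < σ ^ 2 := by positivity
  have h4 : 0 < σ ^ 2 + postVar κ σ D x := add_pos_of_pos_of_nonneg h3 (hpv D x)
  have h5 : (((D.snoc (x, y)).1 : ℕ) : ℝ) = D.1 + 1 := by simp [Data.snoc]
  have h6 : 1 + (σ ^ 2)⁻¹ * postVar κ σ D x = (σ ^ 2 + postVar κ σ D x) / σ ^ 2 := by
    field_simp
  change infoGain κ σ (D.snoc (x, y)).points = 1 / 2 * (Real.log (regGram κ σ _).det - _) at h1
  change infoGain κ σ D.points = 1 / 2 * (Real.log (regGram κ σ _).det - _) at h2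
  rw [h1, h2, det_regGram_snoc hsym D x y (hpsd D), Real.log_mul (hpsd D).det_pos.ne' h4.ne', h5, h6,
    Real.log_div h4.ne' h3.ne']
  ring

theorem postVar_le (hpsd : ∀ D : Data A, (regGram κ σ D).PosDef) (D : Data A) (x : A) :
    postVar κ σ D x ≤ κ x x := by
  have h := (hpsd D).inv.posSemidef.dotProduct_mulVec_nonneg (kvec κ D x)
  rw [star_trivial] at h
  rw [postVar]
  linarith

/-- Needed to know that the supremum defining the maximum information gain is over a bounded set, so
that it really dominates each gain. -/
theorem infoGain_le (hσ : 0 < σ) (hsym : ∀ x x', κ x x' = κ x' x)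
    (hpsd : ∀ D : Data A, (regGram κ σ D).PosDef) (hpv : ∀ D x, 0 ≤ postVar κ σ D x)
    (h1 : ∀ x, κ x x ≤ 1) {n : ℕ} (p : Fin n → A) :
    infoGain κ σ p ≤ n * (1 / 2 * Real.log (1 + (σ ^ 2)⁻¹)) := by
  have h3 : (0 : ℝ) < (σ ^ 2)⁻¹ := by positivity
  induction n with
  | zero => simp [infoGain, gaussianEntropy]
  | succ n ih =>
    -- The targets are arbitrary: gain and posterior variance depend only on the points.
    let D : Data A := ⟨n, fun i => (p i.castSucc, 0)⟩
    have e : (D.snoc (p (Fin.last n), 0)).points = p := by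
      ext i
      change (Fin.snoc (α := fun _ => A × ℝ) D.2 (p (Fin.last n), 0) i).1 = p i
      refine Fin.lastCases ?_ (fun i => ?_) i
      · rw [Fin.snoc_last]
      · rw [Fin.snoc_castSucc]
    have h2 := infoGain_snoc hσ hsym hpsd hpv D (p (Fin.last n)) 0
    rw [e] at h2
    refine h2.trans_le ?_
    have h4 : infoGain κ σ D.points ≤ n * (1 / 2 * Real.log (1 + (σ ^ 2)⁻¹)) :=
      ih fun i => p i.castSucc
    have h5 : Real.log (1 + (σ ^ 2)⁻¹ * postVar κ σ D (p (Fin.last n))) ≤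
        Real.log (1 + (σ ^ 2)⁻¹) := by
      refine Real.log_le_log ?_ ?_
      · have := mul_nonneg h3.le (hpv D (p (Fin.last n)))
        linarith
      · have := mul_le_mul_of_nonneg_left ((postVar_le hpsd D (p (Fin.last n))).trans (h1 _)) h3.le
        linarith
    push_cast
    linarith

theorem infoGain_le_maxInfoGain (hσ : 0 < σ) (hsym : ∀ x x', κ x x' = κ x' x)
    (hpsd : ∀ D : Data A, (regGram κ σ D).PosDef) (hpv : ∀ D x, 0 ≤ postVar κ σ D x)
    (h1 : ∀ x, κ x x ≤ 1) {n : ℕ} (p : Fin n → A) : infoGain κ σ p ≤ maxInfoGain κ σ n :=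
  le_ciSup (f := fun p : Fin n → A => infoGain κ σ p) ⟨_, by
    rintro _ ⟨q, rfl⟩
    exact infoGain_le hσ hsym hpsd hpv h1 q⟩ p

/-- Bernoulli's inequality (1 + a)^s ≤ 1 + as for exponents in [0, 1]. It converts a variance s ≤
κ(x, x) ≤ 1 into an increment of the information gain. -/
theorem mul_log_one_add_le {a s : ℝ} (ha : 0 < a) (hs0 : 0 ≤ s) (hs1 : s ≤ 1) :
    s * Real.log (1 + a) ≤ Real.log (1 + a * s) := by
  have h := rpow_one_add_le_one_add_mul_self (s := a) (by linarith) hs0 hs1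
  have h2 := Real.log_le_log (by positivity) h
  rwa [Real.log_rpow (by linarith), mul_comm s a] at h2

variable {ε : ℝ} {rule : ℕ → Data A → A} {g : A → ℝ} {e : ℕ → ℝ}

theorem sum_updateTimes_succ (T : ℕ) (h : ℕ → ℝ) :
    ∑ t ∈ updateTimes κ σ ε rule g e (T + 1), h t =
      ∑ t ∈ updateTimes κ σ ε rule g e T, h t +
        if T + 1 ∈ updateTimes κ σ ε rule g e (T + 1) then h (T + 1) else 0 := by
  classical
  simp only [updateTimes, Finset.sum_filter, Finset.mem_filter]
  rw [Finset.sum_Icc_succ_top (by omega)]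
  congr 1
  simp

/-- The posterior variances at the sampled points are controlled by the information gain. -/
theorem sum_postVar_le (hσ : 0 < σ) (hsym : ∀ x x', κ x x' = κ x' x)
    (hpsd : ∀ D : Data A, (regGram κ σ D).PosDef) (hpv : ∀ D x, 0 ≤ postVar κ σ D x)
    (h1 : ∀ x, κ x x ≤ 1) (T : ℕ) :
    Real.log (1 + (σ ^ 2)⁻¹) * ∑ t ∈ updateTimes κ σ ε rule g e T,
      postVar κ σ (run κ σ ε rule g e (t - 1)) (action κ σ ε rule g e t) ≤
      2 * infoGain κ σ (run κ σ ε rule g e T).points := by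
  induction T with
  | zero =>
    have h0 : infoGain κ σ (n := 0) (Data.points (⟨0, Fin.elim0⟩ : Data A)) = 0 := by
      simp [infoGain, gaussianEntropy]
    change _ ≤ 2 * infoGain κ σ (n := 0) (Data.points (⟨0, Fin.elim0⟩ : Data A))
    rw [h0]
    simp [updateTimes]
  | succ T ih =>
    rw [sum_updateTimes_succ, mul_add]
    by_cases h : ε < condEntropy κ σ (run κ σ ε rule g e T) (rule (T + 1) (run κ σ ε rule g e T))
    · have hmem : T + 1 ∈ updateTimes κ σ ε rule g e (T + 1) := by
        classical
        simp only [updateTimes, Finset.mem_filter, Finset.mem_Icc]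
        exact ⟨⟨by omega, le_rfl⟩, h⟩
      have hrun : run κ σ ε rule g e (T + 1) = (run κ σ ε rule g e T).snoc
          (rule (T + 1) (run κ σ ε rule g e T),
            g (rule (T + 1) (run κ σ ε rule g e T)) + e (T + 1)) := by
        rw [run_succ, step, if_pos h]
      rw [if_pos hmem, hrun, infoGain_snoc hσ hsym hpsd hpv]
      have h2 := mul_log_one_add_le (a := (σ ^ 2)⁻¹) (by positivity)
        (hpv (run κ σ ε rule g e T) (rule (T + 1) (run κ σ ε rule g e T)))
        ((postVar_le hpsd _ _).trans (h1 _))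
      simp only [action, Nat.add_sub_cancel] at ih ⊢
      linarith
    · have hmem : T + 1 ∉ updateTimes κ σ ε rule g e (T + 1) := by
        classical
        simp only [updateTimes, Finset.mem_filter, Finset.mem_Icc]
        exact fun hh => h hh.2
      have hrun : run κ σ ε rule g e (T + 1) = run κ σ ε rule g e T := by
        rw [run_succ, step, if_neg h]
      rw [if_neg hmem, hrun, mul_zero, add_zero]
      exact ih

/-- Regret bound from pointwise bounds on the instantaneous regrets. -/
theorem updateRegret_le (hσ : 0 < σ) (hsym : ∀ x x', κ x x' = κ x' x)
    (hpsd : ∀ D : Data A, (regGram κ σ D).PosDef) (hpv : ∀ D x, 0 ≤ postVar κ σ D x)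
    (h1 : ∀ x, κ x x ≤ 1) (T : ℕ) {β err : ℕ → ℝ} (hβ : ∀ t, 1 ≤ t → t ≤ T → β t ≤ β T)
    (herr : ∀ t, 0 ≤ err t)
    (h : ∀ t, 1 ≤ t → t ≤ T → (⨆ x, g x) - g (action κ σ ε rule g e t) ≤
      err t + 2 * √(β t) *
        √(postVar κ σ (run κ σ ε rule g e (t - 1)) (action κ σ ε rule g e t))) :
    updateRegret κ σ ε rule g e T ≤
      regretBound κ σ (β T) (modelOrder κ σ ε rule g e T) + ∑ t ∈ Finset.Icc 1 T, err t := by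
  classical
  set U := updateTimes κ σ ε rule g e T with hU
  have hUsub : U ⊆ Finset.Icc 1 T := Finset.filter_subset _ _
  set s : ℕ → ℝ := fun t =>
    postVar κ σ (run κ σ ε rule g e (t - 1)) (action κ σ ε rule g e t) with hs
  have hs0 : ∀ t, 0 ≤ s t := fun t => hpv _ _
  have step1 : updateRegret κ σ ε rule g e T ≤
      ∑ t ∈ U, (err t + 2 * √(β T) * √(s t)) := by
    refine Finset.sum_le_sum fun t ht => ?_
    obtain ⟨ht1, ht2⟩ := Finset.mem_Icc.mp (hUsub ht)
    refine (h t ht1 ht2).trans ?_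
    gcongr
    exact hβ t ht1 ht2
  rw [Finset.sum_add_distrib, ← Finset.mul_sum] at step1
  have step2 : ∑ t ∈ U, err t ≤ ∑ t ∈ Finset.Icc 1 T, err t :=
    Finset.sum_le_sum_of_subset_of_nonneg hUsub fun t _ _ => herr t
  have hlog : 0 < Real.log (1 + (σ ^ 2)⁻¹) := Real.log_pos (by
    have : 0 < (σ ^ 2)⁻¹ := by positivity
    linarith)
  have hcard : modelOrder κ σ ε rule g e T = U.card := modelOrder_eq_card _ _ _ _ _ _ _
  have hsum : Real.log (1 + (σ ^ 2)⁻¹) * ∑ t ∈ U, s t ≤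
      2 * maxInfoGain κ σ (modelOrder κ σ ε rule g e T) := by
    refine (sum_postVar_le hσ hsym hpsd hpv h1 T).trans ?_
    have := infoGain_le_maxInfoGain hσ hsym hpsd hpv h1 (run κ σ ε rule g e T).points
    exact mul_le_mul_of_nonneg_left this (by norm_num)
  have step3 : 2 * √(β T) * ∑ t ∈ U, √(s t) ≤
      regretBound κ σ (β T) (modelOrder κ σ ε rule g e T) := by
    -- A nonpositive β_T has square root 0 by convention, and the regret bound is still nonnegative.
    rcases le_or_gt (β T) 0 with hb | hb
    · rw [Real.sqrt_eq_zero_of_nonpos hb]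
      simp only [mul_zero, zero_mul]
      exact Real.sqrt_nonneg _
    · refine Real.le_sqrt_of_sq_le ?_
      have hcs : (∑ t ∈ U, √(s t)) ^ 2 ≤ U.card * ∑ t ∈ U, s t := by
        refine (sq_sum_le_card_mul_sum_sq).trans (le_of_eq ?_)
        congr 1
        exact Finset.sum_congr rfl fun t _ => Real.sq_sqrt (hs0 t)
      have hsum' : ∑ t ∈ U, s t ≤ 2 * maxInfoGain κ σ (modelOrder κ σ ε rule g e T) /
          Real.log (1 + (σ ^ 2)⁻¹) := by
        rw [le_div_iff₀ hlog, mul_comm]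
        exact hsum
      -- Cauchy–Schwarz; the 8 in C₁ is 4 from squaring 2√β times 2 from the factor 1/2 in the
      -- entropy.
      calc (2 * √(β T) * ∑ t ∈ U, √(s t)) ^ 2
          = 4 * β T * (∑ t ∈ U, √(s t)) ^ 2 := by
            rw [mul_pow, mul_pow, Real.sq_sqrt hb.le]
            norm_num
        _ ≤ 4 * β T * (U.card * ∑ t ∈ U, s t) := by gcongr
        _ ≤ 4 * β T * (U.card * (2 * maxInfoGain κ σ (modelOrder κ σ ε rule g e T) /
              Real.log (1 + (σ ^ 2)⁻¹))) := by gcongr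
        _ = _ := by
            rw [hcard]
            ring
  linarith

end InformationGain

/-! ### Small ℓ¹-nets by packing. -/

section Covering

variable {d : ℕ}

/-- Pairwise `ℓ¹`-distances exceed `ρ`. -/
def L1Separated (ρ : ℝ) (C : Finset (Fin d → ℝ)) : Prop :=
  ∀ x ∈ C, ∀ y ∈ C, x ≠ y → ρ < ∑ j, |x j - y j|

/-- Sum of the pairwise distances of points of an interval of length `w`. -/
theorem sum_sum_abs_sub_le {α : Type*} (C : Finset α) {u : α → ℝ} {w : ℝ} (hw : 0 < w)
    (hu : ∀ x ∈ C, 0 ≤ u x ∧ u x ≤ w) :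
    ∑ x ∈ C, ∑ y ∈ C, |u x - u y| ≤ w * C.card ^ 2 / 2 := by
  -- For u x ≥ u y the difference of the two sides is 2 u y (w − u x). The right side factors after
  -- summation, and s(Nw − s) ≤ (Nw)²/4 finishes.
  have h1 : ∀ x ∈ C, ∀ y ∈ C, |u x - u y| * w ≤ u x * (w - u y) + u y * (w - u x) := by
    intro x hx y hy
    obtain ⟨hx0, hxw⟩ := hu x hx
    obtain ⟨hy0, hyw⟩ := hu y hy
    rcases abs_cases (u x - u y) with ⟨h, _⟩ | ⟨h, _⟩ <;> rw [h]
    · nlinarith [mul_nonneg hy0 (sub_nonneg.mpr hxw)]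
    · nlinarith [mul_nonneg hx0 (sub_nonneg.mpr hyw)]
  have h2 : (∑ x ∈ C, ∑ y ∈ C, |u x - u y|) * w ≤
      2 * ((∑ x ∈ C, u x) * (C.card * w - ∑ x ∈ C, u x)) := by
    rw [Finset.sum_mul]
    have h3 : ∑ x ∈ C, (∑ y ∈ C, |u x - u y|) * w ≤
        ∑ x ∈ C, ∑ y ∈ C, (u x * (w - u y) + u y * (w - u x)) := by
      refine Finset.sum_le_sum fun x hx => ?_
      rw [Finset.sum_mul]
      exact Finset.sum_le_sum fun y hy => h1 x hx y hy
    refine h3.trans (le_of_eq ?_)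
    have h4 : ∑ x ∈ C, ∑ y ∈ C, u x * (w - u y) =
        (∑ x ∈ C, u x) * (C.card * w - ∑ x ∈ C, u x) := by
      rw [← Finset.sum_mul_sum]
      simp [Finset.sum_sub_distrib]
    have h5 : ∑ x ∈ C, ∑ y ∈ C, u y * (w - u x) =
        (∑ x ∈ C, u x) * (C.card * w - ∑ x ∈ C, u x) := by
      rw [Finset.sum_comm, h4]
    simp_rw [Finset.sum_add_distrib]
    rw [h4, h5, two_mul]
  refine le_of_mul_le_mul_right (h2.trans ?_) hw
  nlinarith [sq_nonneg (2 * ∑ x ∈ C, u x - C.card * w)]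

/-- Plotkin-type bound for separated points in a box. -/
theorem card_le_of_separated_box {C : Finset (Fin d → ℝ)} {ρ w : ℝ} (hρ : 0 ≤ ρ) (hw : 0 < w)
    (hC : L1Separated ρ C) {a : Fin d → ℝ} (ha : ∀ x ∈ C, ∀ j, a j ≤ x j ∧ x j ≤ a j + w) :
    (C.card - 1) * ρ ≤ d * w * C.card / 2 := by
  classical
  rcases C.eq_empty_or_nonempty with rfl | hne
  · simpa using hρ
  have hN : (0 : ℝ) < C.card := by exact_mod_cast hne.card_pos
  have hup : ∑ x ∈ C, ∑ y ∈ C, ∑ j, |x j - y j| ≤ d * (w * C.card ^ 2 / 2) := by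
    have : ∑ x ∈ C, ∑ y ∈ C, ∑ j, |x j - y j| = ∑ j, ∑ x ∈ C, ∑ y ∈ C, |x j - y j| := by
      simp_rw [Finset.sum_comm (s := C) (t := Finset.univ)]
    rw [this]
    have h1 : ∀ j ∈ (Finset.univ : Finset (Fin d)), ∑ x ∈ C, ∑ y ∈ C, |x j - y j| ≤
        w * C.card ^ 2 / 2 := by
      intro j _
      have := sum_sum_abs_sub_le C (u := fun x => x j - a j) hw fun x hx => by
        obtain ⟨h1, h2⟩ := ha x hx j
        constructor <;> linarith
      simpa using this
    refine (Finset.sum_le_sum h1).trans (le_of_eq ?_)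
    simp
  -- The total of pairwise distances is counted twice: coordinatewise from above, pairwise from
  -- below.
  have hlow : (C.card : ℝ) * ((C.card - 1) * ρ) ≤ ∑ x ∈ C, ∑ y ∈ C, ∑ j, |x j - y j| := by
    have h1 : ∀ x ∈ C, (C.card - 1) * ρ ≤ ∑ y ∈ C, ∑ j, |x j - y j| := by
      intro x hx
      rw [← Finset.add_sum_erase C _ hx]
      have h2 : ((C.erase x).card : ℝ) * ρ ≤ ∑ y ∈ C.erase x, ∑ j, |x j - y j| := by
        rw [← nsmul_eq_mul]
        exact Finset.card_nsmul_le_sum _ _ _ fun y hy =>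
          (hC x hx y (Finset.mem_of_mem_erase hy) (Finset.ne_of_mem_erase hy).symm).le
      rw [Finset.card_erase_of_mem hx, Nat.cast_sub hne.card_pos, Nat.cast_one] at h2
      simpa using h2
    rw [← nsmul_eq_mul]
    exact Finset.card_nsmul_le_sum _ _ _ h1
  have h := hlow.trans hup
  refine le_of_mul_le_mul_left (h.trans (le_of_eq ?_)) hN
  ring

/-- The cube is cut into n^d cells of side r/n. In each cell the Plotkin bound with ρ = dr/τ and w =
r/n becomes (2n − τ)m ≤ 2n, independently of d and r. -/
theorem card_le_of_separated_cells (hd : 0 < d) {r τ : ℝ} (hr : 0 < r) (hτ : 0 < τ) {n : ℕ}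
    (hn : 0 < n) {C : Finset (Fin d → ℝ)} (hC : L1Separated (d * r / τ) C)
    (hbox : ∀ x ∈ C, ∀ j, 0 ≤ x j ∧ x j ≤ r) :
    (2 * n - τ) * C.card ≤ (n : ℝ) ^ d * (2 * n) := by
  classical
  have hn' : (0 : ℝ) < n := by exact_mod_cast hn
  have hd' : (0 : ℝ) < d := by exact_mod_cast hd
  -- The minimum puts the endpoint z = r into the last cell.
  let cell : ℝ → Fin n := fun z => ⟨min ⌊z * n / r⌋₊ (n - 1), by omega⟩
  have hcell : ∀ z, 0 ≤ z → z ≤ r →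
      (cell z : ℕ) * (r / n) ≤ z ∧ z ≤ (cell z : ℕ) * (r / n) + r / n := by
    intro z h0 h1
    have hz : 0 ≤ z * n / r := by positivity
    have e : z = z * n / r * (r / n) := by field_simp
    have hrn : 0 < r / n := by positivity
    have h2 : ((cell z : ℕ) : ℝ) ≤ z * n / r := by
      refine le_trans ?_ (Nat.floor_le hz)
      exact_mod_cast min_le_left _ _
    have h3 : z * n / r ≤ (cell z : ℕ) + 1 := by
      rcases le_total ⌊z * n / r⌋₊ (n - 1) with h | h
      · have : (cell z : ℕ) = ⌊z * n / r⌋₊ := min_eq_left h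
        rw [this]
        exact (Nat.lt_floor_add_one _).le
      · have : (cell z : ℕ) = n - 1 := min_eq_right h
        rw [this, Nat.cast_sub hn, Nat.cast_one, sub_add_cancel, div_le_iff₀ hr, mul_comm]
        gcongr
    constructor
    · exact (mul_le_mul_of_nonneg_right h2 hrn.le).trans e.ge
    · rw [← add_one_mul]
      exact e.le.trans (mul_le_mul_of_nonneg_right h3 hrn.le)
  let φ : (Fin d → ℝ) → Fin d → Fin n := fun x j => cell (x j)
  have hfib : ∀ c ∈ (Finset.univ : Finset (Fin d → Fin n)),
      (2 * n - τ) * ((C.filter fun x => φ x = c).card : ℝ) ≤ 2 * n := by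
    intro c _
    have h := card_le_of_separated_box (C := C.filter fun x => φ x = c) (w := r / n)
      (ρ := d * r / τ) (by positivity) (by positivity)
      (fun x hx y hy => hC x (Finset.mem_of_mem_filter x hx) y (Finset.mem_of_mem_filter y hy))
      (a := fun j => (c j : ℕ) * (r / n)) (fun x hx j => by
        obtain ⟨hx1, hx2⟩ := Finset.mem_filter.mp hx
        obtain ⟨h0, h1⟩ := hbox x hx1 j
        rw [← hx2]
        exact hcell _ h0 h1)
    set m : ℝ := ((C.filter fun x => φ x = c).card : ℝ)
    have e1 : (m - 1) * (d * r / τ) = (d * r / (2 * n * τ)) * ((m - 1) * (2 * n)) := by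
      field_simp
    have e2 : d * (r / n) * m / 2 = (d * r / (2 * n * τ)) * (m * τ) := by
      field_simp
    rw [e1, e2] at h
    have := le_of_mul_le_mul_left h (by positivity)
    linarith
  have hsum : (C.card : ℝ) = ∑ c : Fin d → Fin n, ((C.filter fun x => φ x = c).card : ℝ) := by
    exact_mod_cast Finset.card_eq_sum_card_fiberwise fun x _ => Finset.mem_univ (φ x)
  rw [hsum, Finset.mul_sum]
  refine (Finset.sum_le_sum hfib).trans (le_of_eq ?_)
  simp

/-- The number of cells per side is chosen according to τ. Rounding τ up could cost a factor
exponential in d; between 5/3 and 2 either 2^d is comparable to τ^d, or the undivided cube already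
gives a bound linear in d. The extra 1 is reserved for the confidence event at the selected point.
-/
theorem card_add_one_le_of_separated (hd : 0 < d) {r τ : ℝ} (hr : 0 < r) (hτ : 1 ≤ τ)
    {C : Finset (Fin d → ℝ)} (hC : L1Separated (d * r / τ) C)
    (hbox : ∀ x ∈ C, ∀ j, 0 ≤ x j ∧ x j ≤ r) : (C.card : ℝ) + 1 ≤ 6 * τ ^ d := by
  have hτ0 : 0 < τ := by linarith
  have hpow : 1 ≤ τ ^ d := one_le_pow₀ hτ
  have hN0 : (0 : ℝ) ≤ C.card := Nat.cast_nonneg _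
  have hd1 : (1 : ℝ) ≤ d := by exact_mod_cast hd
  have key := fun (n : ℕ) (hn : 0 < n) => card_le_of_separated_cells hd hr hτ0 hn hC hbox
  -- For τ ≥ 2 take n = ⌊τ⌋; then 2n − τ ≥ n/2, so the cardinality is at most 4τ^d.
  rcases le_or_gt 2 τ with h2 | h2
  · have hfl := Nat.floor_le hτ0.le
    have hfl2 := Nat.lt_floor_add_one τ
    have hn2 : 2 ≤ ⌊τ⌋₊ := Nat.le_floor (by exact_mod_cast h2)
    have k := key ⌊τ⌋₊ (by omega)
    have hn2' : (2 : ℝ) ≤ ⌊τ⌋₊ := by exact_mod_cast hn2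
    have h3 : (⌊τ⌋₊ : ℝ) * (C.card / 2) ≤ ⌊τ⌋₊ * (2 * (⌊τ⌋₊ : ℝ) ^ d) := by
      have h4 : (⌊τ⌋₊ : ℝ) / 2 ≤ 2 * ⌊τ⌋₊ - τ := by linarith
      have h5 := mul_le_mul_of_nonneg_right h4 hN0
      linarith
    have h6 := le_of_mul_le_mul_left h3 (by linarith)
    have h7 : (⌊τ⌋₊ : ℝ) ^ d ≤ τ ^ d := by gcongr
    linarith
  -- For τ < 5/3 a single cell gives cardinality below 2/(1/3) = 6, hence at most 5 by integrality.
  rcases lt_or_ge τ (5 / 3) with h5 | h5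
  · have k := key 1 one_pos
    norm_num at k
    have h6 : (C.card : ℝ) < 6 := by nlinarith
    have h7 : C.card ≤ 5 := by
      have : C.card < 6 := by exact_mod_cast h6
      omega
    have h8 : (C.card : ℝ) ≤ 5 := by exact_mod_cast h7
    linarith
  -- If d(2 − τ) ≤ 1, Bernoulli gives (τ/2)^d ≥ 1/2 and n = 2 suffices. Otherwise n = 1 gives at
  -- most 2/(2 − τ) < 2d points, while τ^d ≥ 1 + 2d/3.
  rcases le_or_gt (d * (2 - τ)) 1 with h6 | h6
  · have k := key 2 two_pos
    norm_num at k
    have h7 : 1 + (d : ℝ) * (τ / 2 - 1) ≤ (1 + (τ / 2 - 1)) ^ d :=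
      one_add_mul_le_pow (by linarith) d
    have h8 : (1 + (τ / 2 - 1)) ^ d = τ ^ d / 2 ^ d := by
      rw [← div_pow]
      congr 1
      ring
    have h9 : (1 : ℝ) ≤ 2 ^ d := one_le_pow₀ (by norm_num)
    have h10 : 1 / 2 ≤ τ ^ d / 2 ^ d := by
      rw [← h8]
      linarith
    rw [div_le_div_iff₀ (by norm_num) (by positivity)] at h10
    have h11 : 2 * (C.card : ℝ) ≤ (4 - τ) * C.card :=
      mul_le_mul_of_nonneg_right (by linarith) hN0
    linarith
  · have k := key 1 one_pos
    norm_num at k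
    have h7 : 1 + (d : ℝ) * (τ - 1) ≤ (1 + (τ - 1)) ^ d := one_add_mul_le_pow (by linarith) d
    rw [add_sub_cancel] at h7
    have h8 : (C.card : ℝ) ≤ d * (2 - τ) * C.card := by nlinarith
    have h9 : d * ((2 - τ) * C.card) ≤ d * 2 := mul_le_mul_of_nonneg_left k (by linarith)
    have h10 : d * (2 / 3) ≤ (d : ℝ) * (τ - 1) :=
      mul_le_mul_of_nonneg_left (by linarith) (by linarith)
    linarith

/-- Subsets of a cube have small `ℓ¹`-nets consisting of their own points. -/
theorem exists_l1_net (hd : 0 < d) {r τ : ℝ} (hr : 0 < r) (hτ : 1 ≤ τ) {S : Set (Fin d → ℝ)}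
    (hS : S ⊆ Set.Icc 0 fun _ => r) :
    ∃ C : Finset (Fin d → ℝ), (∀ x ∈ C, x ∈ S) ∧
      (∀ x ∈ S, ∃ y ∈ C, ∑ j, |x j - y j| ≤ d * r / τ) ∧ (C.card : ℝ) + 1 ≤ 6 * τ ^ d := by
  classical
  have hτ0 : 0 < τ := by linarith
  have hbound : ∀ C : Finset (Fin d → ℝ), (∀ x ∈ C, x ∈ S) → L1Separated (d * r / τ) C →
      (C.card : ℝ) + 1 ≤ 6 * τ ^ d := fun C hCS hC =>
    card_add_one_le_of_separated hd hr hτ hC fun x hx j =>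
      ⟨(hS (hCS x hx)).1 j, (hS (hCS x hx)).2 j⟩
  let N : Set ℕ := {n | ∃ C : Finset (Fin d → ℝ), (∀ x ∈ C, x ∈ S) ∧
    L1Separated (d * r / τ) C ∧ C.card = n}
  have hN : N.Nonempty := ⟨0, ∅, by simp, by simp [L1Separated], rfl⟩
  have hB : BddAbove N := by
    refine ⟨⌊6 * τ ^ d⌋₊, ?_⟩
    rintro _ ⟨C, hCS, hC, rfl⟩
    refine Nat.le_floor ?_
    linarith [hbound C hCS hC]
  -- A separated subset of maximal cardinality is a net: an uncovered point could be added to it.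
  -- Its points lie in S, as they must, since the payoff is only controlled there.
  obtain ⟨C, hCS, hC, hcard⟩ := Nat.sSup_mem hN hB
  refine ⟨C, hCS, fun x hx => ?_, hbound C hCS hC⟩
  by_contra! hcon
  have hxC : x ∉ C := fun hxC => by
    have := hcon x hxC
    simp only [sub_self, abs_zero, Finset.sum_const_zero] at this
    have h2 : 0 ≤ d * r / τ := by positivity
    linarith
  have hmem : C.card + 1 ∈ N := by
    refine ⟨insert x C, ?_, ?_, Finset.card_insert_of_notMem hxC⟩
    · intro y hy
      rcases Finset.mem_insert.mp hy with rfl | hy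
      · exact hx
      · exact hCS y hy
    · intro y hy z hz hyz
      rcases Finset.mem_insert.mp hy with hy' | hy' <;>
        rcases Finset.mem_insert.mp hz with hz' | hz'
      · exact absurd (hy'.trans hz'.symm) hyz
      · rw [hy']
        exact hcon z hz'
      · rw [hz']
        simp_rw [abs_sub_comm (y _)]
        exact hcon y hy'
      · exact hC y hy' z hz' hyz
  have := le_csSup hB hmem
  omega

end Covering

theorem ofReal_one_sub_le_measure {Ω : Type*} [MeasurableSpace Ω] {P : Measure Ω}
    [IsProbabilityMeasure P] {δ : ℝ} {p : Ω → Prop} (hδ : 0 ≤ δ)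
    (h : P {ω | ¬ p ω} ≤ ENNReal.ofReal δ) : ENNReal.ofReal (1 - δ) ≤ P {ω | p ω} := by
  rw [ENNReal.ofReal_sub _ hδ, ENNReal.ofReal_one]
  refine tsub_le_iff_right.mpr ?_
  calc (1 : ENNReal) = P ({ω | p ω} ∪ {ω | ¬ p ω}) := by
        rw [show {ω | p ω} ∪ {ω | ¬ p ω} = Set.univ from Set.union_compl_self _, measure_univ]
    _ ≤ P {ω | p ω} + P {ω | ¬ p ω} := measure_union_le _ _
    _ ≤ P {ω | p ω} + ENNReal.ofReal δ := by gcongr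

theorem sum_Icc_inv_sq_le (T : ℕ) : ∑ t ∈ Finset.Icc 1 T, 1 / (t : ℝ) ^ 2 ≤ Real.pi ^ 2 / 6 :=
  sum_le_hasSum _ (fun t _ => by positivity) hasSum_zeta_two

/-! ### Union bound and the finite decision set. -/

section Regret

variable {Ω : Type*} [MeasurableSpace Ω] {P : Measure Ω}

theorem IsGPModel.congr {A : Type*} {κ : A → A → ℝ} {σ : ℝ} {f f' : A → Ω → ℝ} {η : ℕ → Ω → ℝ}
    (h : IsGPModel P κ σ f η) (hm : ∀ x, Measurable (f' x))
    (he : ∀ᵐ ω ∂P, ∀ x, f x ω = f' x ω) : IsGPModel P κ σ f' η where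
  measurable_payoff := hm
  gaussian := h.gaussian.congr fun x => he.mono fun _ hω => hω x
  mean_zero x := by
    rw [← h.mean_zero x]
    exact integral_congr_ae (he.mono fun _ hω => (hω x).symm)
  covariance_eq x x' := by
    rw [← h.covariance_eq x x']
    have hi : ∀ x, ∫ ω, f' x ω ∂P = ∫ ω, f x ω ∂P := fun x =>
      integral_congr_ae (he.mono fun _ hω => (hω x).symm)
    rw [covariance, covariance, hi x, hi x']
    exact integral_congr_ae (he.mono fun _ hω => by simp only [hω x, hω x'])
  measurable_noise := h.measurable_noise
  noise_law := h.noise_law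
  noise_indep := h.noise_indep
  indep := h.indep.congr (he.mono fun _ hω => funext hω) (Filter.EventuallyEq.refl _ _)

theorem IsUCBRule.measurable_rule {A : Type*} [MeasurableSpace A] {κ : A → A → ℝ} {σ : ℝ}
    {β : ℕ → ℝ} {rule : ℕ → Data A → A} (h : IsUCBRule κ σ β rule) (t : ℕ) :
    Measurable (rule t) := measurable_of_sigma fun n => h.measurable t n

/-- High-probability regret bound, given finite nets `C t` on which the confidence bounds are
applied at the times `t` with `act t`. -/
theorem measure_regret_gt_le [IsProbabilityMeasure P] {A : Type*} [TopologicalSpace A] [TopologicalSpace.MetrizableSpace A]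
    [SecondCountableTopology A] [MeasurableSpace A] [BorelSpace A]
    {κ : A → A → ℝ} {σ ε : ℝ} {f : A → Ω → ℝ} {η : ℕ → Ω → ℝ} (hσ : 0 < σ)
    (hM : IsGPModel P κ σ f η) (hfc : ∀ ω, Continuous fun x => f x ω) (hκ1 : ∀ x, κ x x ≤ 1)
    {β : ℕ → ℝ} {rule : ℕ → Data A → A} (hr : IsUCBRule κ σ β rule) (T : ℕ)
    (hβ : ∀ t, 1 ≤ t → t ≤ T → β t ≤ β T) {err : ℕ → ℝ} (herr : ∀ t, 0 ≤ err t)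
    (act : ℕ → Prop) [DecidablePred act] (hβ0 : ∀ t, 1 ≤ t → act t → 0 ≤ β t)
    (C : ℕ → Finset A) (B : Set Ω)
    (hnet : ∀ ω, ω ∉ B → ∀ t, 1 ≤ t → act t → ∀ x, ∃ y ∈ C t, f x ω - f y ω ≤ err t)
    (hosc : ∀ ω, ω ∉ B → ∀ t, 1 ≤ t → ¬ act t → ∀ x y, f x ω - f y ω ≤ err t) :
    P {ω | ¬ updateRegret κ σ ε rule (fun x => f x ω) (fun t => η t ω) T ≤
      regretBound κ σ (β T) (modelOrder κ σ ε rule (fun x => f x ω) (fun t => η t ω) T) +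
        ∑ t ∈ Finset.Icc 1 T, err t} ≤
      P B + ∑ t ∈ (Finset.Icc 1 T).filter act,
        ENNReal.ofReal (((C t).card + 1) * (1 / 2 * Real.exp (-β t / 2))) := by
  have hrm := hr.measurable_rule
  let D : ℕ → Ω → Data A := fun t ω =>
    run κ σ ε rule (fun x => f x ω) (fun t => η t ω) (t - 1)
  let Up : ℕ → A → Set Ω := fun t y => {ω | √(β t) * √(postVar κ σ (D t ω) y) <
    1 * (f y ω - postMean κ σ (D t ω) y)}
  let Lo : ℕ → Set Ω := fun t => {ω | √(β t) * √(postVar κ σ (D t ω) (rule t (D t ω))) <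
    -1 * (f (rule t (D t ω)) ω - postMean κ σ (D t ω) (rule t (D t ω)))}
  have hUp : ∀ t, 1 ≤ t → act t → ∀ y, P (Up t y) ≤
      ENNReal.ofReal (1 / 2 * Real.exp (-β t / 2)) := by
    intro t ht ha y
    have h := confidence_tail (ε := ε) hσ hM hfc hrm (t - 1) (ξ := fun _ => y) measurable_const
      (s := 1) (by norm_num) (Real.sqrt_nonneg (β t))
    rwa [Real.sq_sqrt (hβ0 t ht ha)] at h
  -- The selected point is a measurable function of the data held, so one event suffices for the
  -- lower bound.
  have hLo : ∀ t, 1 ≤ t → act t → P (Lo t) ≤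
      ENNReal.ofReal (1 / 2 * Real.exp (-β t / 2)) := by
    intro t ht ha
    have h := confidence_tail (ε := ε) hσ hM hfc hrm (t - 1) (ξ := rule t) (hrm t)
      (s := -1) (by norm_num) (Real.sqrt_nonneg (β t))
    rwa [Real.sq_sqrt (hβ0 t ht ha)] at h
  have hsub : {ω | ¬ updateRegret κ σ ε rule (fun x => f x ω) (fun t => η t ω) T ≤
      regretBound κ σ (β T) (modelOrder κ σ ε rule (fun x => f x ω) (fun t => η t ω) T) +
        ∑ t ∈ Finset.Icc 1 T, err t} ⊆
      B ∪ ⋃ t ∈ (Finset.Icc 1 T).filter act, ((⋃ y ∈ C t, Up t y) ∪ Lo t) := by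
    intro ω hω
    by_contra hcon
    simp only [Set.mem_union, Set.mem_iUnion, Finset.mem_filter, Finset.mem_Icc, not_or,
      not_exists] at hcon
    obtain ⟨hB, hcon⟩ := hcon
    refine hω ?_
    have hL : ∀ x, MemLp (f x) 2 P := fun x => (hM.gaussian.hasGaussianLaw_eval x).memLp_two
    refine updateRegret_le hσ
      (fun x x' => by rw [← hM.covariance_eq, ← hM.covariance_eq, covariance_comm])
      (fun D => add_smul_one_posDef (gram_posSemidef hL hM.covariance_eq D.points) hσ)
      (postVar_nonneg hσ hM.measurable_payoff hM.gaussian hM.mean_zero hM.covariance_eq)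
      hκ1 T hβ herr fun t ht hT => ?_
    have : Nonempty A := ⟨rule t (D t ω)⟩
    change (⨆ x, f x ω) - f (rule t (D t ω)) ω ≤
      err t + 2 * √(β t) * √(postVar κ σ (D t ω) (rule t (D t ω)))
    rw [sub_le_iff_le_add]
    refine ciSup_le fun x => ?_
    -- With confidence bounds active: x is replaced by a net point, then upper bound there,
    -- maximality of the acquisition function, and lower bound at the selected point. Otherwise the
    -- oscillation of the payoff alone is within the error.
    by_cases ha : act t
    · obtain ⟨y, hy, hxy⟩ := hnet ω hB t ht ha x
      obtain ⟨h1, h2⟩ := hcon t ⟨⟨ht, hT⟩, ha⟩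
      have h3 : ¬ (√(β t) * √(postVar κ σ (D t ω) y) <
        1 * (f y ω - postMean κ σ (D t ω) y)) := h1 y hy
      have h4 : ¬ (√(β t) * √(postVar κ σ (D t ω) (rule t (D t ω))) <
        -1 * (f (rule t (D t ω)) ω - postMean κ σ (D t ω) (rule t (D t ω)))) := h2
      have h5 := hr.isMax t ht (D t ω) y
      simp only [ucb] at h5
      linarith
    · have h1 := hosc ω hB t ht ha x (rule t (D t ω))
      have h2 : 0 ≤ 2 * √(β t) * √(postVar κ σ (D t ω) (rule t (D t ω))) := by positivity
      linarith
  refine (measure_mono hsub).trans ((measure_union_le _ _).trans ?_)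
  gcongr
  refine (measure_biUnion_finset_le _ _).trans (Finset.sum_le_sum fun t ht => ?_)
  obtain ⟨ht, ha⟩ := Finset.mem_filter.mp ht
  have ht1 := (Finset.mem_Icc.mp ht).1
  refine (measure_union_le _ _).trans ?_
  have h1 : P (⋃ y ∈ C t, Up t y) ≤
      (C t).card * ENNReal.ofReal (1 / 2 * Real.exp (-β t / 2)) := by
    refine (measure_biUnion_finset_le _ _).trans ?_
    refine (Finset.sum_le_sum fun y _ => hUp t ht1 ha y).trans (le_of_eq ?_)
    rw [Finset.sum_const, nsmul_eq_mul]
  refine (add_le_add h1 (hLo t ht1 ha)).trans (le_of_eq ?_)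
  rw [ENNReal.ofReal_mul (p := ((C t).card : ℝ) + 1) (by positivity),
    ENNReal.ofReal_add (by positivity) zero_le_one, ENNReal.ofReal_natCast, ENNReal.ofReal_one, add_mul, one_mul]

theorem exp_neg_half_two_mul_log {z : ℝ} (hz : 0 < z) : Real.exp (-(2 * Real.log z) / 2) = z⁻¹ := by
  rw [show -(2 * Real.log z) / 2 = -Real.log z by ring, Real.exp_neg, Real.exp_log hz]

/-- Regret bound for a finite decision set. -/
theorem finite_regret [IsProbabilityMeasure P] {A : Type*} [Fintype A] [MeasurableSpace A] [DiscreteMeasurableSpace A]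
    {κ : A → A → ℝ} {σ ε δ : ℝ} {f : A → Ω → ℝ} {η : ℕ → Ω → ℝ} (hσ : 0 < σ)
    (hδ : δ ∈ Set.Ioo (0 : ℝ) 1) {rule : ℕ → Data A → A} (hκ1 : ∀ x, κ x x ≤ 1)
    (hM : IsGPModel P κ σ f η) (hr : IsUCBRule κ σ (betaFinite (Fintype.card A) δ) rule) (T : ℕ) :
    ENNReal.ofReal (1 - δ) ≤
        P {ω | updateRegret κ σ ε rule (fun x => f x ω) (fun t => η t ω) T ≤
          regretBound κ σ (betaFinite (Fintype.card A) δ T)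
            (modelOrder κ σ ε rule (fun x => f x ω) (fun t => η t ω) T)} := by
  obtain ⟨hδ0, hδ1⟩ := hδ
  refine ofReal_one_sub_le_measure hδ0.le ?_
  let _ : TopologicalSpace A := ⊥
  have : DiscreteTopology A := ⟨rfl⟩
  have : BorelSpace A := ⟨by
    rw [borel_eq_top_of_discrete]
    exact MeasurableSpace.ext fun s => ⟨fun _ => trivial, fun _ => MeasurableSet.of_discrete⟩⟩
  have : Nonempty A := ⟨rule 0 ⟨0, Fin.elim0⟩⟩
  have hX : (1 : ℝ) ≤ Fintype.card A := by exact_mod_cast Fintype.card_pos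
  have hpi : 9 < Real.pi ^ 2 := by nlinarith [Real.pi_gt_three]
  have hz : ∀ t : ℕ, 1 ≤ t → 1 ≤ Fintype.card A * (t : ℝ) ^ 2 * Real.pi ^ 2 / (6 * δ) := by
    intro t ht
    have ht' : (1 : ℝ) ≤ t := by exact_mod_cast ht
    rw [one_le_div (by positivity)]
    have h1 : 1 ≤ (t : ℝ) ^ 2 := one_le_pow₀ ht'
    have h2 : 1 ≤ (Fintype.card A : ℝ) * (t : ℝ) ^ 2 := one_le_mul_of_one_le_of_one_le hX h1
    nlinarith
  have key := measure_regret_gt_le (ε := ε) hσ hM (fun ω => continuous_of_discreteTopology) hκ1 hr T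
    (fun t ht hT => by
      have := hz t ht
      simp only [betaFinite]
      gcongr) (err := fun _ => 0) (fun _ => le_rfl) (fun _ => True)
    (fun t ht _ => mul_nonneg (by norm_num) (Real.log_nonneg (hz t ht))) (fun _ => Finset.univ) ∅
    (fun ω _ t _ _ x => ⟨x, Finset.mem_univ _, by simp⟩) (fun ω _ t _ h => absurd trivial h)
  simp only [Finset.sum_const_zero, add_zero, measure_empty, zero_add, Finset.filter_true,
    Finset.card_univ] at key
  refine key.trans ?_
  rw [← ENNReal.ofReal_sum_of_nonneg fun t _ => by positivity]
  refine ENNReal.ofReal_le_ofReal ?_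
  -- The one-sided factor 1/2 absorbs the additional event: (X + 1)/2 ≤ X. The terms then sum to at
  -- most δ by ζ(2) = π²/6.
  have hterm : ∀ t ∈ Finset.Icc 1 T, ((Fintype.card A : ℝ) + 1) *
      (1 / 2 * Real.exp (-betaFinite (Fintype.card A) δ t / 2)) ≤
      6 * δ / Real.pi ^ 2 * (1 / (t : ℝ) ^ 2) := by
    intro t ht
    have ht1 := (Finset.mem_Icc.mp ht).1
    have ht' : (0 : ℝ) < t := by exact_mod_cast ht1
    rw [betaFinite, exp_neg_half_two_mul_log (by linarith [hz t ht1]), inv_div]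
    have e : 6 * δ / Real.pi ^ 2 * (1 / (t : ℝ) ^ 2) = (2 * Fintype.card A) *
        (1 / 2 * (6 * δ / (Fintype.card A * (t : ℝ) ^ 2 * Real.pi ^ 2))) := by
      field_simp
    rw [e]
    gcongr
    linarith
  refine (Finset.sum_le_sum hterm).trans ?_
  rw [← Finset.mul_sum]
  refine (mul_le_mul_of_nonneg_left (sum_Icc_inv_sq_le T) (by positivity)).trans (le_of_eq ?_)
  field_simp

end Regret

/-- Mean value inequality along the segment from y to x, which stays in S by convexity. -/
theorem HasPartialsOn.sub_le {d : ℕ} {S : Set (Fin d → ℝ)} {g : (Fin d → ℝ) → ℝ}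
    {g' : (Fin d → ℝ) → Fin d → ℝ} (h : HasPartialsOn S g g') (hS : Convex ℝ S) {L : ℝ}
    (hL : ∀ x ∈ S, ∀ j, |g' x j| ≤ L) {x y : Fin d → ℝ} (hx : x ∈ S) (hy : y ∈ S) :
    g x - g y ≤ L * ∑ j, |x j - y j| := by
  let c : ℝ → Fin d → ℝ := fun t => y + t • (x - y)
  have hc : ∀ t ∈ Set.Icc (0 : ℝ) 1, c t ∈ S := fun t ht =>
    hS.add_smul_sub_mem hy hx ht
  have hc' : ∀ t, HasDerivWithinAt c (x - y) (Set.Icc 0 1) t := fun t => by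
    have := (((hasDerivAt_id t).smul_const (x - y)).const_add y).hasDerivWithinAt (s := Set.Icc 0 1)
    rwa [one_smul] at this
  have hd : ∀ t ∈ Set.Icc (0 : ℝ) 1, HasDerivWithinAt (g ∘ c)
      (∑ j, g' (c t) j * (x j - y j)) (Set.Icc 0 1) t := fun t ht => by
    have := (h (c t) (hc t ht)).comp_hasDerivWithinAt t (hc' t) hc
    simpa using this
  have hb : ∀ t ∈ Set.Icc (0 : ℝ) 1, ‖∑ j, g' (c t) j * (x j - y j)‖ ≤
      L * ∑ j, |x j - y j| := fun t ht => by
    rw [Finset.mul_sum]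
    refine (norm_sum_le _ _).trans (Finset.sum_le_sum fun j _ => ?_)
    rw [Real.norm_eq_abs, abs_mul]
    exact mul_le_mul_of_nonneg_right (hL _ (hc t ht) j) (abs_nonneg _)
  have := (convex_Icc (0 : ℝ) 1).norm_image_sub_le_of_norm_hasDerivWithin_le hd hb
    (Set.left_mem_Icc.mpr zero_le_one) (Set.right_mem_Icc.mpr zero_le_one)
  simp only [Function.comp, c, one_smul, zero_smul, add_zero, add_sub_cancel, sub_zero, norm_one,
    mul_one, Real.norm_eq_abs] at this
  exact (le_abs_self _).trans this

theorem HasPartialsOn.continuous {d : ℕ} {S : Set (Fin d → ℝ)} {g : (Fin d → ℝ) → ℝ}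
    {g' : (Fin d → ℝ) → Fin d → ℝ} (h : HasPartialsOn S g g') : Continuous fun x : S => g x :=
  continuousOn_iff_continuous_domRestrict.mp fun x hx => (h x hx).continuousWithinAt

theorem updateRegret_eq_zero {A : Type*} [Nonempty A] {κ : A → A → ℝ} {σ ε : ℝ}
    {rule : ℕ → Data A → A} {g : A → ℝ} {e : ℕ → ℝ} {T : ℕ} (h : ∀ x y, g x ≤ g y) :
    updateRegret κ σ ε rule g e T = 0 := by
  refine Finset.sum_eq_zero fun t _ => sub_eq_zero.mpr ?_
  rw [show g = fun _ => g (action κ σ ε rule g e t) from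
    funext fun x => le_antisymm (h _ _) (h _ _), ciSup_const]

/-! ### The compact convex decision set. -/

section General

variable {Ω : Type*} [MeasurableSpace Ω] {P : Measure Ω}

theorem measure_exists_lt_abs_le {d : ℕ} {S : Set (Fin d → ℝ)} {a b : ℝ}
    {f' : (Fin d → ℝ) → Ω → Fin d → ℝ}
    (htail : ∀ j : Fin d, ∀ L : ℝ, 0 < L →
        P {ω | ∃ x ∈ S, L < |f' x ω j|} ≤ ENNReal.ofReal (a * Real.exp (-(L / b) ^ 2)))
    {L : ℝ} (hL : 0 < L) :
    P {ω | ∃ j, ∃ x ∈ S, L < |f' x ω j|} ≤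
      ENNReal.ofReal (d * (a * Real.exp (-(L / b) ^ 2))) := by
  rw [Set.ofPred_exists]
  refine (measure_iUnion_fintype_le _ _).trans ((Finset.sum_le_sum fun j _ => htail j L hL).trans ?_)
  rw [Finset.sum_const, Finset.card_univ, Fintype.card_fin, nsmul_eq_mul,
    ENNReal.ofReal_mul (p := (d : ℝ)) (by positivity), ENNReal.ofReal_natCast]

/-- The tail bound is at most a at each level L = 1/(n + 1), and the events increase to the event of
a nonzero partial derivative. -/
theorem measure_exists_pos_abs_le {d : ℕ} {S : Set (Fin d → ℝ)} {a b : ℝ}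
    {f' : (Fin d → ℝ) → Ω → Fin d → ℝ} (ha : 0 ≤ a)
    (htail : ∀ j : Fin d, ∀ L : ℝ, 0 < L →
        P {ω | ∃ x ∈ S, L < |f' x ω j|} ≤ ENNReal.ofReal (a * Real.exp (-(L / b) ^ 2))) :
    P {ω | ∃ j, ∃ x ∈ S, 0 < |f' x ω j|} ≤ ENNReal.ofReal (d * a) := by
  have hmono : Monotone fun n : ℕ => {ω | ∃ j, ∃ x ∈ S, 1 / ((n : ℝ) + 1) < |f' x ω j|} := by
    rintro m n hmn ω ⟨j, x, hx, h⟩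
    refine ⟨j, x, hx, lt_of_le_of_lt ?_ h⟩
    exact one_div_le_one_div_of_le (by positivity) (by gcongr)
  have hU : {ω | ∃ j, ∃ x ∈ S, 0 < |f' x ω j|} =
      ⋃ n : ℕ, {ω | ∃ j, ∃ x ∈ S, 1 / ((n : ℝ) + 1) < |f' x ω j|} := by
    ext ω
    simp only [Set.mem_ofPred_eq, Set.mem_iUnion]
    constructor
    · rintro ⟨j, x, hx, h⟩
      obtain ⟨n, hn⟩ := exists_nat_one_div_lt h
      exact ⟨n, j, x, hx, hn⟩
    · rintro ⟨n, j, x, hx, h⟩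
      exact ⟨j, x, hx, lt_trans (by positivity) h⟩
  rw [hU, hmono.measure_iUnion]
  refine iSup_le fun n => (measure_exists_lt_abs_le htail (by positivity)).trans
    (ENNReal.ofReal_le_ofReal ?_)
  refine mul_le_mul_of_nonneg_left ?_ (by positivity)
  refine mul_le_of_le_one_right ha (Real.exp_le_one_iff.mpr ?_)
  exact neg_nonpos.mpr (sq_nonneg _)

/-- A version of the payoff all of whose paths are continuous on `S`. -/
theorem exists_continuous_version {d : ℕ} {S : Set (Fin d → ℝ)} {κ : S → S → ℝ} {σ : ℝ}
    {f : (Fin d → ℝ) → Ω → ℝ} {f' : (Fin d → ℝ) → Ω → Fin d → ℝ} {η : ℕ → Ω → ℝ}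
    (hM : IsGPModel P κ σ (fun x : S => f x) η)
    (hpart : ∀ᵐ ω ∂P, HasPartialsOn S (fun x => f x ω) (fun x => f' x ω)) :
    ∃ (h : S → Ω → ℝ) (N : Set Ω), IsGPModel P κ σ h η ∧ (∀ ω, Continuous fun x => h x ω) ∧
      P N = 0 ∧ (∀ ω ∉ N, (∀ x : S, h x ω = f x ω) ∧
        HasPartialsOn S (fun x => f x ω) (fun x => f' x ω)) ∧ ∀ ω ∈ N, ∀ x, h x ω = 0 := by
  classical
  obtain ⟨N, hN, hNm, hN0⟩ := exists_measurable_superset_of_null (ae_iff.mp hpart)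
  have hNc : ∀ ω ∉ N, HasPartialsOn S (fun x => f x ω) (fun x => f' x ω) := fun ω hω =>
    by_contra fun hcon => hω (hN hcon)
  refine ⟨fun x ω => if ω ∈ N then 0 else f x ω, N, ?_, fun ω => ?_, hN0,
    fun ω hω => ⟨fun x => if_neg hω, hNc ω hω⟩, fun ω hω x => if_pos hω⟩
  · refine hM.congr (fun x => Measurable.ite hNm measurable_const (hM.measurable_payoff x)) ?_
    filter_upwards [measure_eq_zero_iff_ae_notMem.mp hN0] with ω hω x
    rw [if_neg hω]
  · by_cases hω : ω ∈ N
    · simpa only [if_pos hω] using continuous_const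
    · simpa only [if_neg hω] using (hNc ω hω).continuous

/-- Regret bound for a compact convex decision set. -/
theorem general_regret [IsProbabilityMeasure P] {σ ε δ : ℝ} (hσ : 0 < σ) (hδ : δ ∈ Set.Ioo (0 : ℝ) 1) {η : ℕ → Ω → ℝ}
    {d : ℕ} {r a b : ℝ} {S : Set (Fin d → ℝ)} {κ : S → S → ℝ} {f : (Fin d → ℝ) → Ω → ℝ}
    {f' : (Fin d → ℝ) → Ω → Fin d → ℝ} {rule : ℕ → Data S → S} (hr : 0 < r) (ha : 0 < a)
    (hb : 0 < b) (hSc : Convex ℝ S) (hS : S ⊆ Set.Icc 0 (fun _ => r)) (hκ1 : ∀ x, κ x x ≤ 1)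
    (hM : IsGPModel P κ σ (fun x : S => f x) η)
    (hpart : ∀ᵐ ω ∂P, HasPartialsOn S (fun x => f x ω) (fun x => f' x ω))
    (htail : ∀ j : Fin d, ∀ L : ℝ, 0 < L →
        P {ω | ∃ x ∈ S, L < |f' x ω j|} ≤ ENNReal.ofReal (a * Real.exp (-(L / b) ^ 2)))
    (hrule : IsUCBRule κ σ (betaGeneral d r a b δ) rule) (T : ℕ) :
    ENNReal.ofReal (1 - δ) ≤
        P {ω | updateRegret κ σ ε rule (fun x : S => f x ω) (fun t => η t ω) T ≤
          regretBound κ σ (betaGeneral d r a b δ T)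
            (modelOrder κ σ ε rule (fun x : S => f x ω) (fun t => η t ω) T) +
              Real.pi ^ 2 / 6} := by
  classical
  obtain ⟨hδ0, hδ1⟩ := hδ
  refine ofReal_one_sub_le_measure hδ0.le ?_
  have hne : Nonempty S := ⟨rule 0 ⟨0, Fin.elim0⟩⟩
  -- When log(4da/δ) ≤ 0 the square root in β_t degenerates. Then da ≤ δ, so with probability at
  -- least 1 − δ all partial derivatives vanish, the payoff is constant on S, and there is no
  -- regret. This covers d = 0.
  rcases le_or_gt (4 * d * a / δ) 1 with hsmall | hlarge
  · have hda : d * a ≤ δ := by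
      rw [div_le_one hδ0] at hsmall
      have : 0 ≤ d * a := by positivity
      linarith
    have hsub : {ω | ¬ updateRegret κ σ ε rule (fun x : S => f x ω) (fun t => η t ω) T ≤
          regretBound κ σ (betaGeneral d r a b δ T)
            (modelOrder κ σ ε rule (fun x : S => f x ω) (fun t => η t ω) T) +
              Real.pi ^ 2 / 6} ⊆
        {ω | ¬ HasPartialsOn S (fun x => f x ω) (fun x => f' x ω)} ∪
          {ω | ∃ j, ∃ x ∈ S, 0 < |f' x ω j|} := by
      intro ω hω
      by_contra hcon
      simp only [Set.mem_union, Set.mem_ofPred_eq, not_or, not_not, not_exists, not_and,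
        not_lt] at hcon
      refine hω ?_
      rw [updateRegret_eq_zero fun x y => ?_]
      · unfold regretBound
        positivity
      · have := hcon.1.sub_le hSc (L := 0) (fun x hx j => hcon.2 j x hx) x.2 y.2
        linarith
    refine (measure_mono hsub).trans ((measure_union_le _ _).trans ?_)
    rw [ae_iff.mp hpart, zero_add]
    exact (measure_exists_pos_abs_le ha.le htail).trans (ENNReal.ofReal_le_ofReal hda)
  have hd : 0 < d := by
    rcases Nat.eq_zero_or_pos d with rfl | h
    · norm_num at hlarge
    · exact h
  have hd' : (0 : ℝ) < d := by exact_mod_cast hd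
  set q := √(Real.log (4 * d * a / δ)) with hq
  have hq0 : 0 < q := Real.sqrt_pos.mpr (Real.log_pos hlarge)
  -- The level L = bq spends exactly δ/4 on the gradient event.
  have hqe : d * (a * Real.exp (-(b * q / b) ^ 2)) = δ / 4 := by
    rw [mul_div_cancel_left₀ _ hb.ne', hq, Real.sq_sqrt (Real.log_pos hlarge).le, Real.exp_neg,
      Real.exp_log (by linarith)]
    field_simp
  -- Chosen so that the Lipschitz constant bq times the net radius dr/τ_t equals 1/t².
  let τ : ℕ → ℝ := fun t => (t : ℝ) ^ 2 * d * b * r * q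
  have hτ0 : ∀ t, 1 ≤ t → 0 < τ t := fun t ht => by
    have : (0 : ℝ) < t := by exact_mod_cast ht
    positivity
  have hβ : ∀ t, betaGeneral d r a b δ t =
      2 * Real.log (2 * t ^ 2 * Real.pi ^ 2 / (3 * δ)) + 2 * d * Real.log (τ t) := fun t => rfl
  have hpi : 9 < Real.pi ^ 2 := by nlinarith [Real.pi_gt_three]
  have hz : ∀ t : ℕ, 1 ≤ t → 1 ≤ 2 * (t : ℝ) ^ 2 * Real.pi ^ 2 / (3 * δ) := by
    intro t ht
    have h1 : 1 ≤ (t : ℝ) ^ 2 := one_le_pow₀ (by exact_mod_cast ht)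
    rw [one_le_div (by positivity)]
    nlinarith
  obtain ⟨h, N, hhM, hhc, hN0, hNc, hN⟩ := exists_continuous_version hM hpart
  have hnet : ∀ t, ∃ C : Finset S, 1 ≤ τ t →
      (∀ x : S, ∃ y ∈ C, ∑ j, |x.1 j - y.1 j| ≤ d * r / τ t) ∧
        (C.card : ℝ) + 1 ≤ 6 * τ t ^ d := by
    intro t
    by_cases hτ : 1 ≤ τ t
    · obtain ⟨C, hCS, hC, hcard⟩ := exists_l1_net hd hr hτ hS
      refine ⟨C.subtype (· ∈ S), fun _ => ⟨fun x => ?_, le_trans ?_ hcard⟩⟩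
      · obtain ⟨y, hy, hxy⟩ := hC x x.2
        exact ⟨⟨y, hCS y hy⟩, by simpa using hy, hxy⟩
      · rw [Finset.card_subtype]
        gcongr
        exact Finset.filter_subset _ _
    · exact ⟨∅, fun h => absurd h hτ⟩
  choose C hC using hnet
  let B : Set Ω := {ω | ∃ j, ∃ x ∈ S, b * q < |f' x ω j|}
  have hPB : P B ≤ ENNReal.ofReal (δ / 4) :=
    hqe ▸ measure_exists_lt_abs_le htail (mul_pos hb hq0)
  have hlip : ∀ ω ∉ B, ∀ x y : S, h x ω - h y ω ≤ b * q * ∑ j, |x.1 j - y.1 j| := by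
    intro ω hω x y
    by_cases hωN : ω ∈ N
    · rw [hN ω hωN, hN ω hωN, sub_zero]
      positivity
    · rw [(hNc ω hωN).1, (hNc ω hωN).1]
      refine (hNc ω hωN).2.sub_le hSc (fun x hx j => ?_) x.2 y.2
      by_contra hcon
      exact hω ⟨j, x, hx, not_le.mp hcon⟩
  have hdiam : ∀ x y : S, ∑ j, |x.1 j - y.1 j| ≤ d * r := by
    intro x y
    have : ∀ j ∈ Finset.univ, |x.1 j - y.1 j| ≤ r := fun j _ => by
      have h1 := (hS x.2).1 j
      have h2 := (hS x.2).2 j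
      have h3 := (hS y.2).1 j
      have h4 := (hS y.2).2 j
      simp only [Pi.zero_apply] at h1 h3
      rw [abs_le]
      constructor <;> linarith
    simpa using Finset.sum_le_sum this
  have key := measure_regret_gt_le (ε := ε) hσ hhM hhc hκ1 hrule T
    (fun t ht hT => by
      have ht' : (0 : ℝ) < t := by exact_mod_cast ht
      have h1 := hτ0 t ht
      have h2 := hz t ht
      have h3 : (t : ℝ) ≤ T := by exact_mod_cast hT
      have h4 : τ t ≤ τ T := by
        simp only [τ]
        gcongr
      rw [hβ, hβ]
      gcongr)
    (err := fun t => 1 / (t : ℝ) ^ 2) (fun t => by positivity) (fun t => 1 ≤ τ t)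
    (fun t ht hact => by
      rw [hβ]
      have h1 := Real.log_nonneg (hz t ht)
      have h2 := Real.log_nonneg hact
      positivity) C B
    (fun ω hω t ht hact x => by
      obtain ⟨y, hy, hxy⟩ := (hC t hact).1 x
      refine ⟨y, hy, (hlip ω hω x y).trans ?_⟩
      have ht' : (0 : ℝ) < t := by exact_mod_cast ht
      refine (mul_le_mul_of_nonneg_left hxy (by positivity)).trans (le_of_eq ?_)
      simp only [τ]
      field_simp)
    -- When τ_t < 1 no net is used: the ℓ¹-diameter is at most dr, and bq·dr = τ_t/t² < 1/t². Here
    -- β_t may be negative.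
    (fun ω hω t ht hact x y => by
      refine (hlip ω hω x y).trans ?_
      have ht' : (0 : ℝ) < t := by exact_mod_cast ht
      refine (mul_le_mul_of_nonneg_left (hdiam x y) (by positivity)).trans ?_
      rw [le_div_iff₀ (by positivity)]
      refine le_trans (le_of_eq ?_) (not_le.mp hact).le
      simp only [τ]
      ring)
  -- The factor τ_t^d cancels: 6τ^d · (1/2) · 3δ/(2t²π²τ^d) = 9δ/(2π²t²). Summed with ζ(2) this is
  -- 3δ/4, which together with the gradient event makes δ.
  have hterm : ∀ t ∈ (Finset.Icc 1 T).filter fun t => 1 ≤ τ t, ENNReal.ofReal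
      (((C t).card + 1) * (1 / 2 * Real.exp (-betaGeneral d r a b δ t / 2))) ≤
      ENNReal.ofReal (9 * δ / (2 * Real.pi ^ 2) * (1 / (t : ℝ) ^ 2)) := by
    intro t ht
    obtain ⟨ht, hact⟩ := Finset.mem_filter.mp ht
    have ht1 := (Finset.mem_Icc.mp ht).1
    have ht' : (0 : ℝ) < t := by exact_mod_cast ht1
    have hτ := hτ0 t ht1
    refine ENNReal.ofReal_le_ofReal ?_
    have e : Real.exp (-betaGeneral d r a b δ t / 2) =
        (2 * (t : ℝ) ^ 2 * Real.pi ^ 2 / (3 * δ) * τ t ^ d)⁻¹ := by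
      have hpos : 0 < 2 * (t : ℝ) ^ 2 * Real.pi ^ 2 / (3 * δ) := by linarith [hz t ht1]
      rw [← exp_neg_half_two_mul_log (mul_pos hpos (pow_pos hτ d)), Real.log_mul hpos.ne'
        (pow_pos hτ d).ne', Real.log_pow, hβ]
      ring_nf
    rw [e]
    refine (mul_le_mul_of_nonneg_right (hC t hact).2 (by positivity)).trans (le_of_eq ?_)
    field_simp
    norm_num
  have hsum : ∑ t ∈ (Finset.Icc 1 T).filter (fun t => 1 ≤ τ t), ENNReal.ofReal
      (((C t).card + 1) * (1 / 2 * Real.exp (-betaGeneral d r a b δ t / 2))) ≤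
      ENNReal.ofReal (3 * δ / 4) := by
    refine (Finset.sum_le_sum hterm).trans ?_
    refine (Finset.sum_le_sum_of_subset (Finset.filter_subset _ _)).trans ?_
    rw [← ENNReal.ofReal_sum_of_nonneg fun t _ => by positivity, ← Finset.mul_sum]
    refine ENNReal.ofReal_le_ofReal ?_
    refine (mul_le_mul_of_nonneg_left (sum_Icc_inv_sq_le T) (by positivity)).trans (le_of_eq ?_)
    field_simp
    norm_num
  have hsub : {ω | ¬ updateRegret κ σ ε rule (fun x : S => f x ω) (fun t => η t ω) T ≤
        regretBound κ σ (betaGeneral d r a b δ T)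
          (modelOrder κ σ ε rule (fun x : S => f x ω) (fun t => η t ω) T) +
            Real.pi ^ 2 / 6} ⊆
      {ω | ¬ updateRegret κ σ ε rule (fun x => h x ω) (fun t => η t ω) T ≤
        regretBound κ σ (betaGeneral d r a b δ T)
          (modelOrder κ σ ε rule (fun x => h x ω) (fun t => η t ω) T) +
            ∑ t ∈ Finset.Icc 1 T, 1 / (t : ℝ) ^ 2} ∪ N := by
    intro ω hω
    by_contra hcon
    simp only [Set.mem_union, Set.mem_ofPred_eq, not_or, not_not] at hcon
    obtain ⟨h1, h2⟩ := hcon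
    rw [show (fun x => h x ω) = fun x : S => f x ω from funext (hNc ω h2).1] at h1
    exact hω (h1.trans (by gcongr; exact sum_Icc_inv_sq_le T))
  refine (measure_mono hsub).trans ((measure_union_le _ _).trans ?_)
  rw [hN0, add_zero]
  refine key.trans ((add_le_add hPB hsum).trans (le_of_eq ?_))
  rw [← ENNReal.ofReal_add (by positivity) (by positivity)]
  congr 1
  ring

end General

end CompressedGPUCB

open CompressedGPUCB in
theorem theorem1 {Ω : Type*} [MeasurableSpace Ω] (P : Measure Ω) [IsProbabilityMeasure P]
    (σ : ℝ) (hσ : 0 < σ) (ε : ℝ) (δ : ℝ) (hδ : δ ∈ Set.Ioo (0 : ℝ) 1) (η : ℕ → Ω → ℝ) :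
    -- (i) finite decision set `A`
    (∀ (A : Type*) [Fintype A] [MeasurableSpace A] [DiscreteMeasurableSpace A]
      (κ : A → A → ℝ) (f : A → Ω → ℝ) (rule : ℕ → Data A → A),
      (∀ x, κ x x ≤ 1) →
      IsGPModel P κ σ f η →
      IsUCBRule κ σ (betaFinite (Fintype.card A) δ) rule →
      ∀ T : ℕ, ENNReal.ofReal (1 - δ) ≤
        P {ω | updateRegret κ σ ε rule (fun x => f x ω) (fun t => η t ω) T ≤
          regretBound κ σ (betaFinite (Fintype.card A) δ T)
            (modelOrder κ σ ε rule (fun x => f x ω) (fun t => η t ω) T)}) ∧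
    -- (ii) compact convex decision set `S ⊆ [0, r]^d`; only the values of `f` on `S` matter
    (∀ (d : ℕ) (r a b : ℝ) (S : Set (Fin d → ℝ)) (κ : S → S → ℝ) (f : (Fin d → ℝ) → Ω → ℝ)
      (f' : (Fin d → ℝ) → Ω → Fin d → ℝ) (rule : ℕ → Data S → S),
      0 < r → 0 < a → 0 < b →
      IsCompact S → Convex ℝ S → S ⊆ Set.Icc 0 (fun _ => r) →
      (∀ x, κ x x ≤ 1) →
      IsGPModel P κ σ (fun x : S => f x) η →
      (∀ᵐ ω ∂P, HasPartialsOn S (fun x => f x ω) (fun x => f' x ω)) →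
      (∀ j : Fin d, ∀ L : ℝ, 0 < L →
        P {ω | ∃ x ∈ S, L < |f' x ω j|} ≤ ENNReal.ofReal (a * Real.exp (-(L / b) ^ 2))) →
      IsUCBRule κ σ (betaGeneral d r a b δ) rule →
      ∀ T : ℕ, ENNReal.ofReal (1 - δ) ≤
        P {ω | updateRegret κ σ ε rule (fun x : S => f x ω) (fun t => η t ω) T ≤
          regretBound κ σ (betaGeneral d r a b δ T)
            (modelOrder κ σ ε rule (fun x : S => f x ω) (fun t => η t ω) T) +
              Real.pi ^ 2 / 6}) := by
  refine ⟨fun A _ _ _ κ f rule hκ1 hM hr T => finite_regret hσ hδ hκ1 hM hr T, ?_⟩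
  intro d r a b S κ f f' rule hr ha hb _ hSc hS hκ1 hM hpart htail hrule T
  exact general_regret hσ hδ hr ha hb hSc hS hκ1 hM hpart htail hrule T
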